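/- Let $N,M\in\mathbb{N}_0$, $f:\mathbb{R}^N\to\mathbb{R}^N$ with $f(0)=0$, $g:\mathbb{R}^N\to\mathbb{R}^{N\times M}$, $r\in C(\mathbb{R}^N,[0,\infty))$ with $r^{-1}(\{0\})=\{0\}$, and let $R\in\mathbb{R}^{M\times M}$ be symmetric positive definite. A process $(\mathbf{x},\mathbf{u})$ is admissible for $x_0$ if $\mathbf{u}:[0,\infty)\to\mathbb{R}^M$ is measurable and $\mathbf{x}$ is a locally absolutely continuous solution on $[0,\infty)$ of $\dot{\mathbf{x}}=f(\mathbf{x})+g(\mathbf{x})\mathbf{u}$, $\mathbf{x}(0)=x_0$. Its cost is $\int_0^\infty r(\mathbf{x}(s))+\mathbf{u}(s)^\top R\,\mathbf{u}(s)\,ds\in[0,\infty]$, the value function $v(x_0)\in[0,\infty]$ is the infimum of the costs of the admissible processes, and an admissible process of cost $v(x_0)$ is called optimal. Let $\mathcal{A}\subset\mathbb{R}^N$ be compact and such that every $x_0\in\mathcal{A}$ has an optimal process, and let $\Omega=\mathcal{T}(\mathcal{A})$ be the closure of the set of all states $\mathbf{x}^*(t)$, $t\ge 0$, of optimal processes $(\mathbf{x}^*,\mathbf{u}^*)$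 starting in $\mathcal{A}$. Assume the following. 1. $f$ and $g$ are $C^1$ in a neighbourhood of each point of $\Omega$. 2. $v$ is radially unbounded: $v(x)\to\infty$ as $\|x\|_2\to\infty$. 3. $v$ is $C^1$ on $\Omega$ with gradient $\nabla v$: $v$ is finite and continuous on $\Omega$; it is differentiable in the interior of $\Omega$, and $\nabla v$ extends continuously to the closure of the interior; at the points of $\Omega$ outside the closure of its interior, $v$ (as a function on $\mathbb{R}^N$) is finite nearby and differentiable; and the function $\nabla v$ on $\Omega$ so obtained is continuous. 4. $S\supseteq\operatorname{conv}(\Omega)$ is a convex set with non-empty interior (one may take $S=\operatorname{conv}(\Omega)$ if this has interior points), and $k\in C^4(S\times S)$ is a strictly positive definite kernel on $S$ with reproducing kernel Hilbert space $\mathcal{H}_k(S)$. Derivatives on $S$ are taken within $S$. 5. On $\Omega$ the value function, together with its gradient, belongs to the RKHS: there is $w\in\mathcal{H}_k(S)$ with $w=v$ and $\nabla w=\nabla v$ on $\Omega$. For a data set $\mathcal{D}$ and a finite set $X\subset\mathcal{D}$, a Hermite kernel interpolant of $v$ with centers $X$ is a function $s=\sum_{y\in X}\alpha_y k(y,\cdot)+\langle\beta_y,\nabla_1k(y,\cdot)\rangle$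 with $\alpha_y\in\mathbb{R}$, $\beta_y\in\mathbb{R}^N$, such that $s(y)=v(y)$ and $\nabla s(y)=\nabla v(y)$ for all $y\in X$. Consider two algorithms. *Greedy exploration with tolerance $\epsilon_d\ge 0$.* Start with $\mathcal{D}=\{0\}$ and $\epsilon=\epsilon_d+1$. While $\epsilon>\epsilon_d$, choose $x_a\in\mathcal{A}$ maximizing the distance to $\mathcal{D}$ over $\mathcal{A}$, set $\epsilon$ to this distance, and add to $\mathcal{D}$ the trajectory $\{\mathbf{x}^*(t):t\ge 0\}$ of an optimal process from $x_a$. *Hermite VKOGA on $\mathcal{D}$ with tolerance $\epsilon_f\ge 0$.* Start with $X=\emptyset$ and $s=0$. While the maximum over $\mathcal{D}\setminus X$ of $|v-s|+\|\nabla v-\nabla s\|_2$ exceeds $\epsilon_f$, add a maximizer to $X$ and let $s$ be the Hermite kernel interpolant with centers $X$. Then for every $T>0$ there is a constant $C_T>0$ such that for all $\epsilon_d,\epsilon_f\ge 0$, every data set $\mathcal{D}$ with which the greedy exploration with tolerance $\epsilon_d$ has terminated, and every $s_v^n$ with which the Hermite VKOGA on $\mathcal{D}$ with tolerance $\epsilon_f$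 has terminated, $$|v(\mathbf{x}^*(t))-s_v^n(\mathbf{x}^*(t))|+\|\nabla v(\mathbf{x}^*(t))-\nabla s_v^n(\mathbf{x}^*(t))\|_2\le C_T\,\epsilon_d+\epsilon_f$$ for all $x_0\in\mathcal{A}$, all optimal processes $(\mathbf{x}^*,\mathbf{u}^*)$ starting at $x_0$, and all $t\in[0,T]$. Thus $C_T$ does not depend on the tolerances or on the interpolant. -/

import Mathlib

open Set Filter Topology MeasureTheory
open scoped ENNReal RealInnerProductSpace Matrix

noncomputable section

/-- The data of the infinite horizon optimal control problem
`min_u ∫₀^∞ r(x(s)) + u(s)ᵀ R u(s) ds` subject to `x' = f(x) + g(x) u`, `x(0) = x₀`,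
with state space `ℝ^N` and control space `ℝ^M`. The matrix `g(x) ∈ ℝ^{N×M}` is regarded as a
linear map `ℝ^M → ℝ^N`. -/
structure ControlProblem (N M : ℕ) where
  f : EuclideanSpace ℝ (Fin N) → EuclideanSpace ℝ (Fin N)
  g : EuclideanSpace ℝ (Fin N) → EuclideanSpace ℝ (Fin M) →L[ℝ] EuclideanSpace ℝ (Fin N)
  r : EuclideanSpace ℝ (Fin N) → ℝ
  R : Matrix (Fin M) (Fin M) ℝ
  f_zero : f 0 = 0
  r_continuous : Continuous r
  r_nonneg : ∀ x, 0 ≤ r x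
  r_eq_zero_iff : ∀ x, r x = 0 ↔ x = 0
  R_posDef : R.PosDef

namespace ControlProblem

variable {N M : ℕ} (P : ControlProblem N M)

/-- `(x, u)` is an admissible process on `[0, ∞)` with initial state `x₀`: the control signal `u` is
measurable and `x` is a (locally absolutely continuous) solution of the controlled ODE, written in
integral form. Values at negative times are irrelevant. -/
structure IsAdmissible (x₀ : EuclideanSpace ℝ (Fin N)) (x : ℝ → EuclideanSpace ℝ (Fin N))
    (u : ℝ → EuclideanSpace ℝ (Fin M)) : Prop where
  measurable_control : Measurable u
  intervalIntegrable : ∀ t : ℝ, 0 ≤ t →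
    IntervalIntegrable (fun s => P.f (x s) + P.g (x s) (u s)) volume 0 t
  eq_integral : ∀ t : ℝ, 0 ≤ t → x t = x₀ + ∫ s in (0 : ℝ)..t, (P.f (x s) + P.g (x s) (u s))

/-- The cost `∫₀^∞ r(x(s)) + u(s)ᵀ R u(s) ds ∈ [0, ∞]`; the integrand is nonnegative. -/
def cost (x : ℝ → EuclideanSpace ℝ (Fin N)) (u : ℝ → EuclideanSpace ℝ (Fin M)) : ℝ≥0∞ :=
  ∫⁻ s in Ici (0 : ℝ), ENNReal.ofReal (P.r (x s) + (u s).ofLp ⬝ᵥ (P.R *ᵥ (u s).ofLp))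

/-- The value function on all of `ℝ^N`, with values in `[0, ∞]` (`∞` where no admissible process
has finite cost). -/
def value (x₀ : EuclideanSpace ℝ (Fin N)) : ℝ≥0∞ :=
  ⨅ (x : ℝ → EuclideanSpace ℝ (Fin N)) (u : ℝ → EuclideanSpace ℝ (Fin M))
    (_ : P.IsAdmissible x₀ x u), P.cost x u

/-- The value function as a real valued function; used only where `P.value` is finite. -/
def valueReal (x₀ : EuclideanSpace ℝ (Fin N)) : ℝ := (P.value x₀).toReal

/-- The value function is of class `C¹` on the closed set `Ω` with gradient `dv`: it is finite and
continuous on `Ω`, `dv` is continuous on `Ω`, and `dv` is the gradient of the value function at the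
interior points of `Ω`, hence on the closure of the interior (as continuous extension). At the
points of `Ω` away from the closure of its interior, where the values on `Ω` do not determine a
gradient, the value function (as a function on `ℝ^N`) has to be differentiable with gradient `dv`.
This determines `dv` on `Ω`. -/
structure HasC1ValueOn (Ω : Set (EuclideanSpace ℝ (Fin N)))
    (dv : EuclideanSpace ℝ (Fin N) → EuclideanSpace ℝ (Fin N)) : Prop where
  finite : ∀ x ∈ Ω, P.value x ≠ ⊤
  continuousOn : ContinuousOn P.valueReal Ω
  continuousOn_gradient : ContinuousOn dv Ω
  hasGradientAt : ∀ x ∈ Ω, x ∈ interior Ω ∨ x ∉ closure (interior Ω) →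
    (∀ᶠ y in 𝓝 x, P.value y ≠ ⊤) ∧ HasGradientAt P.valueReal (dv x) x

/-- `(x, u)` is an optimal process for the initial state `x₀`. -/
def IsOptimal (x₀ : EuclideanSpace ℝ (Fin N)) (x : ℝ → EuclideanSpace ℝ (Fin N))
    (u : ℝ → EuclideanSpace ℝ (Fin M)) : Prop :=
  P.IsAdmissible x₀ x u ∧ P.cost x u = P.value x₀

/-- The domain of interest `𝒯(A)`: the closure of the set of all states of all optimal trajectories
with initial state in `A`. -/
def reachSet (A : Set (EuclideanSpace ℝ (Fin N))) : Set (EuclideanSpace ℝ (Fin N)) :=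
  closure {y | ∃ x₀ ∈ A, ∃ x u, P.IsOptimal x₀ x u ∧ ∃ t : ℝ, 0 ≤ t ∧ y = x t}

/-- The states `(D, ε)` (data set and current cover distance) that the greedy exploration with
tolerance `tol` can reach. It starts with `D = {0}` and `ε = tol + 1`; while `ε > tol` it picks
`x_a ∈ A` at maximal distance from `D`, sets `ε` to that distance and adds an optimal trajectory
starting at `x_a` to `D`. -/
inductive GreedyExploration (A : Set (EuclideanSpace ℝ (Fin N))) (tol : ℝ) :
    Set (EuclideanSpace ℝ (Fin N)) → ℝ → Prop
  | init : GreedyExploration A tol {0} (tol + 1)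
  | step {D : Set (EuclideanSpace ℝ (Fin N))} {ε : ℝ} {xa : EuclideanSpace ℝ (Fin N)}
      {x : ℝ → EuclideanSpace ℝ (Fin N)} {u : ℝ → EuclideanSpace ℝ (Fin M)}
      (prev : GreedyExploration A tol D ε) (continues : tol < ε)
      (mem : xa ∈ A) (farthest : IsMaxOn (fun z => Metric.infDist z D) A xa)
      (optimal : P.IsOptimal xa x u) :
      GreedyExploration A tol (D ∪ x '' Ici (0 : ℝ)) (Metric.infDist xa D)

/-- The greedy exploration with tolerance `tol` has terminated with the data set `D`. -/
def ExplorationOutput (A : Set (EuclideanSpace ℝ (Fin N))) (tol : ℝ)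
    (D : Set (EuclideanSpace ℝ (Fin N))) : Prop :=
  ∃ ε, P.GreedyExploration A tol D ε ∧ ε ≤ tol

end ControlProblem

section Kernel

variable {E : Type*} [NormedAddCommGroup E] [InnerProductSpace ℝ E] [CompleteSpace E]

/-- `k` is a strictly positive definite kernel on `S`: it is symmetric and all Gram matrices of
finite sets of (pairwise distinct) points of `S` are positive definite. -/
def IsSPDKernelOn (k : E → E → ℝ) (S : Set E) : Prop :=
  (∀ x ∈ S, ∀ y ∈ S, k x y = k y x) ∧
    ∀ X : Finset E, (X : Set E) ⊆ S → (Matrix.of fun i j : X => k i j).PosDef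

/-- A function on the subset `S` of `E`, extended by zero. -/
def extendZero {S : Set E} (w : S → ℝ) : E → ℝ :=
  Function.extend Subtype.val w 0

/-- `s` is the Hermite kernel interpolant
`s = ∑_{y ∈ X} α_y k(y, ·) + ⟨β_y, ∇₁ k(y, ·)⟩`
with centers `X`, values `v` and gradients `dv`; gradients are taken within the domain `S` of the
kernel. -/
def IsHermiteInterpolant (k : E → E → ℝ) (S : Set E) (v : E → ℝ) (dv : E → E)
    (X : Finset E) (s : E → ℝ) : Prop :=
  (∃ (α : E → ℝ) (β : E → E), s = fun z =>
      ∑ y ∈ X, (α y * k y z + ⟪β y, gradientWithin (fun y' => k y' z) S y⟫)) ∧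
    ∀ y ∈ X, s y = v y ∧ gradientWithin s S y = dv y

/-- The pointwise error `|v(x) - s(x)| + ‖∇v(x) - ∇s(x)‖` of a surrogate `s`. -/
def hermiteError (S : Set E) (v : E → ℝ) (dv : E → E) (s : E → ℝ) (x : E) : ℝ :=
  |v x - s x| + ‖dv x - gradientWithin s S x‖

/-- The states `(X, s)` (centers and surrogate) that the Hermite VKOGA with data set `D`, values
`v`, gradients `dv` and tolerance `tol` can reach. It starts with `X = ∅` and `s = 0`; while the
maximal error on `D \ X` exceeds `tol`, a maximizer is added to `X` and `s` becomes
the Hermite interpolant with centers `X`. -/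
inductive HermiteVKOGA (k : E → E → ℝ) (S : Set E) (v : E → ℝ) (dv : E → E) (D : Set E)
    (tol : ℝ) : Finset E → (E → ℝ) → Prop
  | init : HermiteVKOGA k S v dv D tol ∅ 0
  | step {X X' : Finset E} {s s' : E → ℝ} {x : E}
      (prev : HermiteVKOGA k S v dv D tol X s)
      (mem : x ∈ D \ (X : Set E)) (greedy : IsMaxOn (hermiteError S v dv s) (D \ (X : Set E)) x)
      (continues : tol < hermiteError S v dv s x)
      (centers : (X' : Set E) = insert x (X : Set E))
      (interpolant : IsHermiteInterpolant k S v dv X' s') :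
      HermiteVKOGA k S v dv D tol X' s'

/-- The Hermite VKOGA with tolerance `tol` has terminated with the surrogate `s`. -/
def VKOGAOutput (k : E → E → ℝ) (S : Set E) (v : E → ℝ) (dv : E → E) (D : Set E) (tol : ℝ)
    (s : E → ℝ) : Prop :=
  ∃ X : Finset E, HermiteVKOGA k S v dv D tol X s ∧
    ∀ x ∈ D \ (X : Set E), hermiteError S v dv s x ≤ tol

end Kernel

end

/-! Two Lipschitz estimates are combined: one in the reproducing kernel Hilbert space, one for the
optimal dynamics.

Kernel side. Let `φ x` represent evaluation at `x`; then the adjoint of the derivative of `φ` at `x`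
gives the gradient at `x`. On the compact convex hull of `Ω`, both `φ` and its derivative are
Lipschitz (`exists_norm_sub_le_of_inner_eq`, `exists_norm_fderivWithin_sub_le_of_inner_eq`), because
squared norms of their increments are mixed second differences of `k` and of its directional mixed
derivatives; hence four derivatives of `k`. A Hermite interpolant of `w` is an orthogonal
projection, so the residual satisfies `‖w - σ‖ ≤ ‖w‖` whatever the centers (`norm_residual_le`). The
pointwise Hermite error is therefore Lipschitz with a constant free of the interpolant
(`hermiteError_le_add`).

Control side. Dynamic programming gives the Hamilton–Jacobi–Bellman inequality on `Ω`, with equality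
almost everywhere along optimal trajectories. The Hamiltonian is a positive definite quadratic in
the control, so equality forces the control to be a feedback of the state and `∇v`
(`eq_feedback_of_hamiltonian`). As `∇v = ∇w` is Lipschitz on `Ω`, all optimal trajectories solve one
ODE with Lipschitz right-hand side.

Conclusion. After exploration `x₀` is within any `δ > εd` of a data point, whose forward closed-loop
trajectory stays in the data set. By Grönwall the two trajectories remain within `δ * exp (K * T)`
on `[0, T]`. The error at points of the data set is at most `εf`, and the Lipschitz bound for the
error transfers this to `x t`. -/

/-! ### Differentiability of Hilbert-space-valued maps from their inner products. -/

section FeatureMaps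

variable {E H : Type*} [NormedAddCommGroup E] [NormedSpace ℝ E]
  [NormedAddCommGroup H] [InnerProductSpace ℝ H]

/-- The mean value inequality is applied to `K - B/2`-type remainders twice: to `K'` in the second
variable, then to the difference of two slices of `K` in the first. With `B` the second derivative
at a point this is a local expansion; with `B = 0` it is a global bound. -/
theorem abs_mixed_difference_sub_le {K : E × E → ℝ} {K' : E × E → (E × E →L[ℝ] ℝ)}
    {K'' : E × E → (E × E →L[ℝ] E × E →L[ℝ] ℝ)} {Q : Set E} (hQ : Convex ℝ Q)
    (hK : ∀ p ∈ Q ×ˢ Q, HasFDerivWithinAt K (K' p) (Q ×ˢ Q) p)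
    (hK' : ∀ p ∈ Q ×ˢ Q, HasFDerivWithinAt K' (K'' p) (Q ×ˢ Q) p)
    (B : E × E →L[ℝ] E × E →L[ℝ] ℝ) {ε : ℝ} (hB : ∀ p ∈ Q ×ˢ Q, ‖K'' p - B‖ ≤ ε)
    {x x' y y' : E} (hx : x ∈ Q) (hx' : x' ∈ Q) (hy : y ∈ Q) (hy' : y' ∈ Q) :
    |K (x, y) - K (x, y') - K (x', y) + K (x', y') - B (0, y - y') (x - x', 0)| ≤
      ε * ‖x - x'‖ * ‖y - y'‖ := by
  have hε : 0 ≤ ε := le_trans (norm_nonneg (K'' (x, y) - B)) (hB (x, y) ⟨hx, hy⟩)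
  have h1 : ∀ z ∈ Q, ‖K' (z, y) - K' (z, y') - B (0, y - y')‖ ≤ ε * ‖y - y'‖ := by
    intro z hz
    have hd : ∀ η ∈ Q, HasFDerivWithinAt (fun η => K' (z, η) - B (0, η))
        ((K'' (z, η) - B).comp (ContinuousLinearMap.inr ℝ E E)) Q η := by
      intro η hη
      have e1 : HasFDerivWithinAt (fun η : E => (z, η)) (ContinuousLinearMap.inr ℝ E E) Q η :=
        (hasFDerivAt_prodMk_right z η).hasFDerivWithinAt
      have e2 := (hK' (z, η) ⟨hz, hη⟩).comp η e1 (fun a ha => ⟨hz, ha⟩)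
      have e3 : HasFDerivWithinAt (fun η : E => B (0, η))
          (B.comp (ContinuousLinearMap.inr ℝ E E)) Q η :=
        (B.comp (ContinuousLinearMap.inr ℝ E E)).hasFDerivWithinAt
      rw [ContinuousLinearMap.sub_comp]
      exact e2.fun_sub e3
    have hb : ∀ η ∈ Q, ‖(K'' (z, η) - B).comp (ContinuousLinearMap.inr ℝ E E)‖ ≤ ε := by
      intro η hη
      refine (ContinuousLinearMap.opNorm_comp_le _ _).trans ?_
      refine (mul_le_mul (hB (z, η) ⟨hz, hη⟩) (ContinuousLinearMap.norm_inr_le_one ℝ E E)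
        (norm_nonneg _) hε).trans_eq (mul_one _)
    have := hQ.norm_image_sub_le_of_norm_hasFDerivWithin_le hd hb hy' hy
    have e : B (0, y - y') = B (0, y) - B (0, y') := by
      rw [← map_sub]; simp
    rw [e]
    rwa [sub_sub_sub_comm] at this
  have hd : ∀ z ∈ Q, HasFDerivWithinAt (fun z => K (z, y) - K (z, y') - B (0, y - y') (z, 0))
      ((K' (z, y) - K' (z, y') - B (0, y - y')).comp (ContinuousLinearMap.inl ℝ E E)) Q z := by
    intro z hz
    have e1 : ∀ η ∈ Q, HasFDerivWithinAt (fun z : E => K (z, η))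
        ((K' (z, η)).comp (ContinuousLinearMap.inl ℝ E E)) Q z := fun η hη =>
      (hK (z, η) ⟨hz, hη⟩).comp z (hasFDerivAt_prodMk_left z η).hasFDerivWithinAt (fun a (ha : a ∈ Q) => show (a, η) ∈ Q ×ˢ Q from ⟨ha, hη⟩)
    have e3 : HasFDerivWithinAt (fun z : E => B (0, y - y') (z, 0))
        ((B (0, y - y')).comp (ContinuousLinearMap.inl ℝ E E)) Q z :=
      ((B (0, y - y')).comp (ContinuousLinearMap.inl ℝ E E)).hasFDerivWithinAt
    rw [ContinuousLinearMap.sub_comp, ContinuousLinearMap.sub_comp]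
    exact ((e1 y hy).fun_sub (e1 y' hy')).fun_sub e3
  have hb : ∀ z ∈ Q, ‖(K' (z, y) - K' (z, y') - B (0, y - y')).comp
      (ContinuousLinearMap.inl ℝ E E)‖ ≤ ε * ‖y - y'‖ := by
    intro z hz
    refine (ContinuousLinearMap.opNorm_comp_le _ _).trans ?_
    exact (mul_le_mul (h1 z hz) (ContinuousLinearMap.norm_inl_le_one ℝ E E)
      (norm_nonneg _) (by positivity)).trans_eq (mul_one _)
  have := hQ.norm_image_sub_le_of_norm_hasFDerivWithin_le hd hb hx' hx
  have e : B (0, y - y') (x - x', 0) = B (0, y - y') (x, 0) - B (0, y - y') (x', 0) := by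
    rw [← map_sub]; simp
  rw [e, ← Real.norm_eq_abs]
  calc _ = _ := by congr 1; ring
    _ ≤ _ := this
    _ = _ := by ring

theorem exists_basis_add_mem [FiniteDimensional ℝ E] {S : Set E} (hint : (interior S).Nonempty)
    (x : E) : ∃ (n : ℕ) (b : Module.Basis (Fin n) ℝ E), ∀ i, x + b i ∈ S := by
  set V : Set E := {e | x + e ∈ S}
  have hspan : Submodule.span ℝ V = ⊤ := by
    apply Submodule.eq_top_of_nonempty_interior'
    obtain ⟨y, hy⟩ := hint
    refine ⟨y - x, mem_interior_iff_mem_nhds.2 ?_⟩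
    have hc : Tendsto (fun e : E => x + e) (𝓝 (y - x)) (𝓝 y) := by
      have : Continuous fun e : E => x + e := by fun_prop
      simpa using this.tendsto (y - x)
    filter_upwards [hc (mem_interior_iff_mem_nhds.1 hy)] with e he
    exact Submodule.subset_span he
  let b := Module.Basis.ofSpan hspan.ge
  have : Finite _ := Module.Finite.finite_basis b
  let b' := b.reindex (Finite.equivFin _)
  refine ⟨_, b', fun i => ?_⟩
  have h := Module.Basis.ofSpan_subset hspan.ge
  have : b' i ∈ V := by
    apply h
    simp only [b', Module.Basis.reindex_apply]
    exact mem_range_self _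
  exact this

/-- Gram data of the increments determine `φ` up to isometry, so their first-order expansion
suffices. Difference quotients in directions pointing into `S` are Cauchy, and enough such
directions exist to form a basis. Their limits define `A`, whose Gram form is `M`; expanding the
square of the remainder then leaves only error terms. -/
theorem exists_hasFDerivWithinAt_of_inner_sub_sub [FiniteDimensional ℝ E] [CompleteSpace H]
    {φ : E → H} {S : Set E} (hS : Convex ℝ S) (hint : (interior S).Nonempty) {x : E} (hx : x ∈ S)
    (M : E →ₗ[ℝ] E →ₗ[ℝ] ℝ)
    (hM : ∀ ε > 0, ∃ δ > 0, ∀ z ∈ S ∩ Metric.ball x δ, ∀ z' ∈ S ∩ Metric.ball x δ,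
      |⟪φ z - φ x, φ z' - φ x⟫ - M (z - x) (z' - x)| ≤ ε * ‖z - x‖ * ‖z' - x‖) :
    ∃ A : E →L[ℝ] H, HasFDerivWithinAt φ A S x := by
  set τ : ℕ → ℝ := fun n => 1 / ((n : ℝ) + 1)
  have hτ0 : ∀ n, 0 < τ n := fun n => Nat.one_div_pos_of_nat
  have hτ1 : ∀ n, τ n ≤ 1 := fun n => by
    simp only [τ]; rw [div_le_one (by positivity)]; simp
  have hτ : Tendsto τ atTop (𝓝 0) := tendsto_one_div_add_atTop_nhds_zero_nat
  have hmem : ∀ e, x + e ∈ S → ∀ n, x + τ n • e ∈ S := fun e he n =>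
    hS.add_smul_mem hx he ⟨(hτ0 n).le, hτ1 n⟩
  have hball : ∀ e, ∀ δ > 0, ∀ᶠ n in atTop, x + τ n • e ∈ Metric.ball x δ := by
    intro e δ hδ
    have : Tendsto (fun n => x + τ n • e) atTop (𝓝 x) := by
      simpa using (hτ.smul_const e).const_add x
    exact this (Metric.ball_mem_nhds x hδ)
  set q : E → ℕ → H := fun e n => (τ n)⁻¹ • (φ (x + τ n • e) - φ x)
  have hq1 : ∀ ε > 0, ∃ δ > 0, ∀ z ∈ S ∩ Metric.ball x δ, ∀ e, x + e ∈ S →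
      ∀ n, x + τ n • e ∈ Metric.ball x δ →
      |⟪φ z - φ x, q e n⟫ - M (z - x) e| ≤ ε * ‖z - x‖ * ‖e‖ := by
    intro ε hε
    obtain ⟨δ, hδ, h⟩ := hM ε hε
    refine ⟨δ, hδ, fun z hz e he n hn => ?_⟩
    have := h z hz _ ⟨hmem e he n, hn⟩
    simp only [add_sub_cancel_left, map_smul, norm_smul, smul_eq_mul, Real.norm_eq_abs,
      abs_of_pos (hτ0 n)] at this
    have e1 : ⟪φ z - φ x, q e n⟫ - M (z - x) e =
        (τ n)⁻¹ * (⟪φ z - φ x, φ (x + τ n • e) - φ x⟫ - τ n * M (z - x) e) := by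
      simp only [q, inner_smul_right]
      have := (hτ0 n).ne'
      field_simp
    rw [e1, abs_mul, abs_of_pos (inv_pos.2 (hτ0 n)), inv_mul_le_iff₀ (hτ0 n)]
    linarith
  have hq2 : ∀ e e', x + e ∈ S → x + e' ∈ S → ∀ ε > 0, ∃ n₀, ∀ n ≥ n₀, ∀ m ≥ n₀,
      |⟪q e n, q e' m⟫ - M e e'| ≤ ε * ‖e‖ * ‖e'‖ := by
    intro e e' he he' ε hε
    obtain ⟨δ, hδ, h⟩ := hq1 ε hε
    obtain ⟨n₀, hn₀⟩ := eventually_atTop.1 ((hball e δ hδ).and (hball e' δ hδ))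
    refine ⟨n₀, fun n hn m hm => ?_⟩
    have := h _ ⟨hmem e he n, (hn₀ n hn).1⟩ e' he' m (hn₀ m hm).2
    simp only [add_sub_cancel_left, map_smul, norm_smul, smul_eq_mul, Real.norm_eq_abs,
      abs_of_pos (hτ0 n), LinearMap.smul_apply] at this
    have e1 : ⟪q e n, q e' m⟫ - M e e' =
        (τ n)⁻¹ * (⟪φ (x + τ n • e) - φ x, q e' m⟫ - τ n * M e e') := by
      have := (hτ0 n).ne'
      simp only [q, real_inner_smul_left]
      field_simp
    rw [e1, abs_mul, abs_of_pos (inv_pos.2 (hτ0 n)), inv_mul_le_iff₀ (hτ0 n)]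
    linarith
  have hlim : ∀ e, x + e ∈ S → ∃ d, Tendsto (q e) atTop (𝓝 d) := by
    intro e he
    apply cauchySeq_tendsto_of_complete
    rw [Metric.cauchySeq_iff]
    intro η hη
    -- In the expansion of `‖q e n - q e m‖ ^ 2` the terms `M e e` cancel, leaving an error of at
    -- most `4 * ε * ‖e‖ ^ 2 < η ^ 2`.
    set ε := η ^ 2 / (8 * (‖e‖ ^ 2 + 1))
    have hε : 0 < ε := by positivity
    obtain ⟨n₀, h⟩ := hq2 e e he he ε hε
    refine ⟨n₀, fun n hn m hm => ?_⟩
    rw [dist_eq_norm]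
    apply lt_of_pow_lt_pow_left₀ 2 hη.le
    have h1 := abs_le.1 (h n hn n hn)
    have h2 := abs_le.1 (h n hn m hm)
    have h3 := abs_le.1 (h m hm m hm)
    have h4 : ε * (8 * (‖e‖ ^ 2 + 1)) = η ^ 2 := by
      simp only [ε]; field_simp
    rw [norm_sub_sq_real, ← real_inner_self_eq_norm_sq, ← real_inner_self_eq_norm_sq]
    nlinarith [h1.2, h2.1, h3.2, hε]
  obtain ⟨N, b, hb⟩ := exists_basis_add_mem hint x
  choose d hd using fun i => hlim (b i) (hb i)
  have hdd : ∀ i j, ⟪d i, d j⟫ = M (b i) (b j) := by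
    intro i j
    have h1 : Tendsto (fun n => ⟪q (b i) n, q (b j) n⟫) atTop (𝓝 ⟪d i, d j⟫) :=
      (hd i).inner (hd j)
    refine tendsto_nhds_unique h1 ?_
    rw [Metric.tendsto_atTop]
    intro η hη
    obtain ⟨n₀, h⟩ := hq2 (b i) (b j) (hb i) (hb j) (η / (2 * (‖b i‖ * ‖b j‖ + 1)))
      (by positivity)
    refine ⟨n₀, fun n hn => ?_⟩
    rw [Real.dist_eq]
    refine (h n hn n hn).trans_lt ?_
    rw [mul_assoc, div_mul_eq_mul_div, div_lt_iff₀ (by positivity)]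
    nlinarith [mul_nonneg (norm_nonneg (b i)) (norm_nonneg (b j))]
  have hφd : ∀ ε > 0, ∃ δ > 0, ∀ z ∈ S ∩ Metric.ball x δ, ∀ i,
      |⟪φ z - φ x, d i⟫ - M (z - x) (b i)| ≤ ε * ‖z - x‖ * ‖b i‖ := by
    intro ε hε
    obtain ⟨δ, hδ, h⟩ := hq1 ε hε
    refine ⟨δ, hδ, fun z hz i => ?_⟩
    have h1 : Tendsto (fun n => |⟪φ z - φ x, q (b i) n⟫ - M (z - x) (b i)|) atTop
        (𝓝 |⟪φ z - φ x, d i⟫ - M (z - x) (b i)|) :=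
      ((tendsto_const_nhds.inner (hd i)).sub_const _).abs
    refine le_of_tendsto h1 ?_
    filter_upwards [hball (b i) δ hδ] with n hn using h z hz _ (hb i) n hn
  set A : E →ₗ[ℝ] H := b.constr ℝ d
  have hA : ∀ i, A (b i) = d i := fun i => b.constr_basis ℝ d i
  have hAA : ∀ a a', ⟪A a, A a'⟫ = M a a' := by
    intro a a'
    have : ((innerₗ H).comp A).compl₂ A = M := by
      apply b.ext; intro i
      apply b.ext; intro j
      simp [hA, hdd]
    rw [← this]; simp
  set C : ℝ := ∑ i, ‖LinearMap.toContinuousLinearMap (b.coord i)‖ * ‖b i‖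
  have hC : 0 ≤ C := Finset.sum_nonneg fun i _ => by positivity
  have hφA : ∀ ε > 0, ∃ δ > 0, ∀ z ∈ S ∩ Metric.ball x δ, ∀ a,
      |⟪φ z - φ x, A a⟫ - M (z - x) a| ≤ ε * ‖z - x‖ * (C * ‖a‖) := by
    intro ε hε
    obtain ⟨δ, hδ, h⟩ := hφd ε hε
    refine ⟨δ, hδ, fun z hz a => ?_⟩
    have e1 : ⟪φ z - φ x, A a⟫ - M (z - x) a =
        ∑ i, b.repr a i * (⟪φ z - φ x, d i⟫ - M (z - x) (b i)) := by
      have e2 : A a = ∑ i, b.repr a i • d i := by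
        conv_lhs => rw [← b.sum_repr a]
        simp only [map_sum, map_smul, hA]
      have e3 : M (z - x) a = ∑ i, b.repr a i * M (z - x) (b i) := by
        conv_lhs => rw [← b.sum_repr a]
        simp only [map_sum, map_smul, smul_eq_mul]
      rw [e2, e3]
      simp only [inner_sum, inner_smul_right, mul_sub, Finset.sum_sub_distrib]
    rw [e1]
    refine (Finset.abs_sum_le_sum_abs _ _).trans ?_
    simp only [C, Finset.sum_mul, Finset.mul_sum]
    refine Finset.sum_le_sum fun i _ => ?_
    rw [abs_mul]
    have h1 : |b.repr a i| ≤ ‖LinearMap.toContinuousLinearMap (b.coord i)‖ * ‖a‖ :=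
      (LinearMap.toContinuousLinearMap (b.coord i)).le_opNorm a
    calc _ ≤ (‖LinearMap.toContinuousLinearMap (b.coord i)‖ * ‖a‖) *
          (ε * ‖z - x‖ * ‖b i‖) := mul_le_mul h1 (h z hz i) (abs_nonneg _) (by positivity)
      _ = _ := by ring
  refine ⟨LinearMap.toContinuousLinearMap A, ?_⟩
  rw [hasFDerivWithinAt_iff_isLittleO, Asymptotics.isLittleO_iff]
  intro η hη
  -- The squared remainder consists of `⟪φ z - φ x, φ z - φ x⟫`, with error factor `ε`, and twice a
  -- cross term, with error factor `ε * C`; the Gram form of `A` is exact.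
  set ε := η ^ 2 / (1 + 2 * C)
  have hε : 0 < ε := by positivity
  have hεη : ε * (1 + 2 * C) = η ^ 2 := by simp only [ε]; field_simp
  obtain ⟨δ₁, hδ₁, h₁⟩ := hM ε hε
  obtain ⟨δ₂, hδ₂, h₂⟩ := hφA ε hε
  filter_upwards [self_mem_nhdsWithin, nhdsWithin_le_nhds (Metric.ball_mem_nhds x hδ₁),
    nhdsWithin_le_nhds (Metric.ball_mem_nhds x hδ₂)] with z hzS hz1 hz2
  have g1 := abs_le.1 (h₁ z ⟨hzS, hz1⟩ z ⟨hzS, hz1⟩)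
  have g2 := abs_le.1 (h₂ z ⟨hzS, hz2⟩ (z - x))
  have g3 := hAA (z - x) (z - x)
  apply le_of_sq_le_sq _ (by positivity)
  rw [LinearMap.coe_toContinuousLinearMap', norm_sub_sq_real, ← real_inner_self_eq_norm_sq,
    ← real_inner_self_eq_norm_sq, g3, mul_pow, ← hεη]
  nlinarith [g1.2, g2.1]

end FeatureMaps

/-! ### Lipschitz regularity of the kernel features and their derivatives. -/

section KernelFeatures

variable {E H : Type*} [NormedAddCommGroup E] [NormedSpace ℝ E]
  [NormedAddCommGroup H] [InnerProductSpace ℝ H]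

theorem real_inner_sub_sub_sub (a b c d : H) :
    ⟪a - b, c - d⟫ = ⟪a, c⟫ - ⟪a, d⟫ - ⟪b, c⟫ + ⟪b, d⟫ := by
  simp only [inner_sub_left, inner_sub_right]; ring

theorem differentiableWithinAt_of_inner_eq [FiniteDimensional ℝ E] [CompleteSpace H]
    {φ : E → H} {S : Set E} (hS : Convex ℝ S) (hint : (interior S).Nonempty) {K : E × E → ℝ}
    (hK : ContDiffOn ℝ 2 K (S ×ˢ S)) (hφ : ∀ x ∈ S, ∀ y ∈ S, ⟪φ x, φ y⟫ = K (x, y))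
    {x : E} (hx : x ∈ S) : DifferentiableWithinAt ℝ φ S x := by
  have hU : UniqueDiffOn ℝ (S ×ˢ S) :=
    (uniqueDiffOn_convex hS hint).prod (uniqueDiffOn_convex hS hint)
  have hK1 : ContDiffOn ℝ 1 (fderivWithin ℝ K (S ×ˢ S)) (S ×ˢ S) :=
    hK.fderivWithin hU (by norm_num)
  have hK2 : ContinuousOn (fderivWithin ℝ (fderivWithin ℝ K (S ×ˢ S)) (S ×ˢ S)) (S ×ˢ S) :=
    hK1.continuousOn_fderivWithin hU le_rfl
  -- The Gram form of the derivative of `φ` at `x` must be the mixed part of the second derivative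
  -- of `K` on the diagonal.
  set B := fderivWithin ℝ (fderivWithin ℝ K (S ×ˢ S)) (S ×ˢ S) (x, x)
  let M : E →ₗ[ℝ] E →ₗ[ℝ] ℝ := LinearMap.mk₂ ℝ (fun a b => B (0, b) (a, 0))
    (fun a a' b => by rw [← map_add]; simp) (fun c a b => by rw [← map_smul]; simp)
    (fun a b b' => by rw [← add_apply, ← map_add]; simp)
    (fun c a b => by rw [← smul_apply, ← map_smul]; simp)
  obtain ⟨A, hA⟩ := exists_hasFDerivWithinAt_of_inner_sub_sub hS hint hx M (φ := φ) (by
    intro ε hε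
    obtain ⟨δ, hδ, h⟩ := (Metric.continuousOn_iff (β := E × E →L[ℝ] E × E →L[ℝ] ℝ)).1 hK2 (x, x) ⟨hx, hx⟩ ε hε
    refine ⟨δ, hδ, fun z hz z' hz' => ?_⟩
    have hxx : x ∈ S ∩ Metric.ball x δ := ⟨hx, Metric.mem_ball_self hδ⟩
    have hsub : (S ∩ Metric.ball x δ) ×ˢ (S ∩ Metric.ball x δ) ⊆ S ×ˢ S :=
      prod_mono inter_subset_left inter_subset_left
    have := abs_mixed_difference_sub_le (hS.inter (convex_ball x δ))
      (fun p hp => (((hK.differentiableOn (by norm_num)) p (hsub hp)).hasFDerivWithinAt).mono hsub)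
      (fun p hp => (((hK1.differentiableOn (by norm_num)) p (hsub hp)).hasFDerivWithinAt).mono hsub)
      B (ε := ε) (fun p hp => by
        refine (dist_eq_norm (fderivWithin ℝ (fderivWithin ℝ K (S ×ˢ S)) (S ×ˢ S) p) B).ge.trans
          (h p (hsub hp) ?_).le
        rw [Prod.dist_eq]
        exact max_lt hp.1.2 hp.2.2) hz hxx hz' hxx
    rw [real_inner_sub_sub_sub, hφ z hz.1 z' hz'.1, hφ z hz.1 x hx, hφ x hx z' hz'.1, hφ x hx x hx]
    exact this)
  exact hA.differentiableWithinAt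

/-- `‖φ x - φ y‖ ^ 2` is a mixed second difference of `K`, hence at most `m * ‖x - y‖ ^ 2` with `m`
bounding the second derivative on `Q ×ˢ Q`. -/
theorem exists_norm_sub_le_of_inner_eq
    {φ : E → H} {S : Set E} (hS : UniqueDiffOn ℝ S) {K : E × E → ℝ}
    (hK : ContDiffOn ℝ 2 K (S ×ˢ S)) (hφ : ∀ x ∈ S, ∀ y ∈ S, ⟪φ x, φ y⟫ = K (x, y))
    {Q : Set E} (hQ : Convex ℝ Q) (hQc : IsCompact Q) (hQS : Q ⊆ S) :
    ∃ L, 0 ≤ L ∧ ∀ x ∈ Q, ∀ y ∈ Q, ‖φ x - φ y‖ ≤ L * ‖x - y‖ := by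
  have hU : UniqueDiffOn ℝ (S ×ˢ S) := hS.prod hS
  have hK1 : ContDiffOn ℝ 1 (fderivWithin ℝ K (S ×ˢ S)) (S ×ˢ S) :=
    hK.fderivWithin hU (by norm_num)
  have hK2 : ContinuousOn (fderivWithin ℝ (fderivWithin ℝ K (S ×ˢ S)) (S ×ˢ S)) (S ×ˢ S) :=
    hK1.continuousOn_fderivWithin hU le_rfl
  have hsub : Q ×ˢ Q ⊆ S ×ˢ S := prod_mono hQS hQS
  obtain ⟨m, hm⟩ := (hQc.prod hQc).exists_bound_of_continuousOn
    (E := E × E →L[ℝ] E × E →L[ℝ] ℝ) (hK2.mono hsub)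
  have hn : ∀ T : E × E →L[ℝ] E × E →L[ℝ] ℝ, ‖T - 0‖ = ‖T‖ := fun T =>
    congrArg norm (sub_zero T)
  refine ⟨√m, Real.sqrt_nonneg _, fun x hx y hy => ?_⟩
  have hm0 : 0 ≤ m := (norm_nonneg _).trans (hm (x, x) ⟨hx, hx⟩)
  have := abs_mixed_difference_sub_le hQ
      (fun p hp => (((hK.differentiableOn (by norm_num)) p (hsub hp)).hasFDerivWithinAt).mono hsub)
      (fun p hp => (((hK1.differentiableOn (by norm_num)) p (hsub hp)).hasFDerivWithinAt).mono hsub)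
      0 (ε := m) (fun p hp => by
        exact (hn _).le.trans (hm p hp)) hx hy hx hy
  apply le_of_sq_le_sq _ (by positivity)
  rw [← real_inner_self_eq_norm_sq, mul_pow, Real.sq_sqrt hm0, real_inner_sub_sub_sub,
    hφ x (hQS hx) x (hQS hx), hφ x (hQS hx) y (hQS hy), hφ y (hQS hy) x (hQS hx),
    hφ y (hQS hy) y (hQS hy)]
  have := (abs_le.1 this).2
  simp only [zero_apply, sub_zero] at this
  linarith

/-- For fixed `e`, the map sending `x` to the derivative of `φ` at `x` in direction `e` is again a
feature map, for the mixed derivative of `K` along `e` in both variables. That kernel is `C²`, so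
the previous estimate applies; a basis of directions controls the operator norm. -/
theorem exists_norm_fderivWithin_sub_le_of_inner_eq [FiniteDimensional ℝ E] [CompleteSpace H]
    {φ : E → H} {S : Set E} (hS : Convex ℝ S) (hint : (interior S).Nonempty) {K : E × E → ℝ}
    (hK : ContDiffOn ℝ 4 K (S ×ˢ S)) (hφ : ∀ x ∈ S, ∀ y ∈ S, ⟪φ x, φ y⟫ = K (x, y))
    {Q : Set E} (hQ : Convex ℝ Q) (hQc : IsCompact Q) (hQS : Q ⊆ S) :
    ∃ L, 0 ≤ L ∧ ∀ x ∈ Q, ∀ y ∈ Q,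
      ‖fderivWithin ℝ φ S x - fderivWithin ℝ φ S y‖ ≤ L * ‖x - y‖ := by
  have hUS := uniqueDiffOn_convex hS hint
  have hU : UniqueDiffOn ℝ (S ×ˢ S) := hUS.prod hUS
  have hdφ : ∀ x ∈ S, HasFDerivWithinAt φ (fderivWithin ℝ φ S x) S x := fun x hx =>
    (differentiableWithinAt_of_inner_eq hS hint (hK.of_le (by norm_num)) hφ hx).hasFDerivWithinAt
  have hK1 : ContDiffOn ℝ 3 (fderivWithin ℝ K (S ×ˢ S)) (S ×ˢ S) :=
    hK.fderivWithin hU (by norm_num)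
  have h1 : ∀ e, ∀ x ∈ S, ∀ y ∈ S,
      ⟪fderivWithin ℝ φ S x e, φ y⟫ = fderivWithin ℝ K (S ×ˢ S) (x, y) (e, 0) := by
    intro e x hx y hy
    have d1 : HasFDerivWithinAt (fun z => ⟪φ z, φ y⟫)
        ((innerSL ℝ (φ y)).comp (fderivWithin ℝ φ S x)) S x := by
      have := ((innerSL ℝ (φ y)).hasFDerivAt (x := φ x)).comp_hasFDerivWithinAt x (hdφ x hx)
      refine this.congr (fun z _ => ?_) ?_ <;> simp [real_inner_comm]
    have d2 : HasFDerivWithinAt (fun z => K (z, y))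
        ((fderivWithin ℝ K (S ×ˢ S) (x, y)).comp (ContinuousLinearMap.inl ℝ E E)) S x :=
      ((hK.differentiableOn (by norm_num)) (x, y) ⟨hx, hy⟩).hasFDerivWithinAt.comp x
        (hasFDerivAt_prodMk_left x y).hasFDerivWithinAt
        (fun a (ha : a ∈ S) => show (a, y) ∈ S ×ˢ S from ⟨ha, hy⟩)
    have d3 := d2.congr (f₁ := fun z => ⟪φ z, φ y⟫) (fun z hz => hφ z hz y hy) (hφ x hx y hy)
    have := DFunLike.congr_fun ((hUS x hx).eq d1 d3) e
    simpa [real_inner_comm] using this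
  have h2 : ∀ e, ContDiffOn ℝ 3 (fun p => fderivWithin ℝ K (S ×ˢ S) p (e, 0)) (S ×ˢ S) :=
    fun e => hK1.clm_apply contDiffOn_const
  have h3 : ∀ e, ContDiffOn ℝ 2
      (fun p => fderivWithin ℝ (fun p => fderivWithin ℝ K (S ×ˢ S) p (e, 0)) (S ×ˢ S) p (0, e))
      (S ×ˢ S) :=
    fun e => ((h2 e).fderivWithin hU (by norm_num)).clm_apply contDiffOn_const
  have h4 : ∀ e, ∀ x ∈ S, ∀ y ∈ S, ⟪fderivWithin ℝ φ S x e, fderivWithin ℝ φ S y e⟫ =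
      fderivWithin ℝ (fun p => fderivWithin ℝ K (S ×ˢ S) p (e, 0)) (S ×ˢ S) (x, y) (0, e) := by
    intro e x hx y hy
    have d1 : HasFDerivWithinAt (fun z => ⟪fderivWithin ℝ φ S x e, φ z⟫)
        ((innerSL ℝ (fderivWithin ℝ φ S x e)).comp (fderivWithin ℝ φ S y)) S y :=
      (innerSL ℝ (fderivWithin ℝ φ S x e)).hasFDerivAt.comp_hasFDerivWithinAt y (hdφ y hy)
    have d2 : HasFDerivWithinAt (fun z => fderivWithin ℝ K (S ×ˢ S) (x, z) (e, 0))
        ((fderivWithin ℝ (fun p => fderivWithin ℝ K (S ×ˢ S) p (e, 0)) (S ×ˢ S) (x, y)).comp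
          (ContinuousLinearMap.inr ℝ E E)) S y :=
      (((h2 e).differentiableOn (by norm_num)) (x, y) ⟨hx, hy⟩).hasFDerivWithinAt.comp y
        (hasFDerivAt_prodMk_right x y).hasFDerivWithinAt
        (fun a (ha : a ∈ S) => show (x, a) ∈ S ×ˢ S from ⟨hx, ha⟩)
    have d3 := d2.congr (f₁ := fun z => ⟪fderivWithin ℝ φ S x e, φ z⟫)
      (fun z hz => h1 e x hx z hz) (h1 e x hx y hy)
    have := DFunLike.congr_fun ((hUS y hy).eq d1 d3) e
    simpa using this
  choose L hL0 hL using fun e => exists_norm_sub_le_of_inner_eq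
    (φ := fun x => fderivWithin ℝ φ S x e) hUS (h3 e) (h4 e) hQ hQc hQS
  let b := Module.finBasis ℝ E
  obtain ⟨C, hC, h⟩ := b.exists_opNorm_le (F := H)
  refine ⟨C * ∑ i, L (b i), mul_nonneg hC.le (Finset.sum_nonneg fun i _ => hL0 _), ?_⟩
  intro x hx y hy
  rw [mul_assoc]
  refine h (mul_nonneg (Finset.sum_nonneg fun i _ => hL0 _) (norm_nonneg _)) fun i => ?_
  refine (hL (b i) x hx y hy).trans ?_
  gcongr
  exact Finset.single_le_sum (f := fun i => L (b i)) (fun i _ => hL0 _) (Finset.mem_univ i)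

end KernelFeatures

/-! ### Hermite interpolation as orthogonal projection. -/

section HermiteInterpolation

variable {E H : Type*} [NormedAddCommGroup E] [InnerProductSpace ℝ E] [CompleteSpace E]
  [NormedAddCommGroup H] [InnerProductSpace ℝ H] [CompleteSpace H]

theorem hasGradientWithinAt_inner_left {φ : E → H} {S : Set E} {x : E}
    (hφ : DifferentiableWithinAt ℝ φ S x) (h : H) :
    HasGradientWithinAt (fun z => ⟪φ z, h⟫) ((fderivWithin ℝ φ S x).adjoint h) S x := by
  rw [hasGradientWithinAt_iff_hasFDerivWithinAt]
  have := ((innerSL ℝ h).hasFDerivAt (x := φ x)).comp_hasFDerivWithinAt x hφ.hasFDerivWithinAt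
  have e : InnerProductSpace.toDual ℝ E ((fderivWithin ℝ φ S x).adjoint h) =
      (innerSL ℝ h).comp (fderivWithin ℝ φ S x) := by
    ext z
    simp [ContinuousLinearMap.adjoint_inner_left]
  rw [e]
  refine this.congr (fun z _ => ?_) ?_ <;> simp [real_inner_comm]

theorem HasGradientWithinAt.gradientWithin_eq {f : E → ℝ} {f' x : E} {S : Set E}
    (h : HasGradientWithinAt f f' S x) (hS : UniqueDiffWithinAt ℝ S x) :
    gradientWithin f S x = f' := by
  rw [gradientWithin, (hasGradientWithinAt_iff_hasFDerivWithinAt.1 h).fderivWithin hS]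
  simp

/-- The coefficients of `s` are those of `σ` in the representers of values and gradients at the
centers. An element with zero Hermite data on `X` is orthogonal to all of these. -/
theorem exists_hermiteInterpolant_repr {φ : E → H} {S : Set E} (hS : UniqueDiffOn ℝ S)
    (hφ : DifferentiableOn ℝ φ S) {k : E → E → ℝ} (hk : ∀ x ∈ S, ∀ y ∈ S, ⟪φ x, φ y⟫ = k x y)
    {v : E → ℝ} {dv : E → E} {X : Finset E} (hX : (X : Set E) ⊆ S) {s : E → ℝ}
    (hs : IsHermiteInterpolant k S v dv X s) :
    ∃ σ : H, (∀ z ∈ S, s z = ⟪φ z, σ⟫) ∧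
      ∀ h : H, (∀ y ∈ X, ⟪φ y, h⟫ = 0 ∧ (fderivWithin ℝ φ S y).adjoint h = 0) → ⟪h, σ⟫ = 0 := by
  obtain ⟨⟨α, β, rfl⟩, -⟩ := hs
  refine ⟨∑ y ∈ X, (α y • φ y + fderivWithin ℝ φ S y (β y)), fun z hz => ?_, fun h hh => ?_⟩
  · simp only [inner_sum]
    refine Finset.sum_congr rfl fun y hy => ?_
    have hyS := hX hy
    have hg : HasGradientWithinAt (fun y' => k y' z) ((fderivWithin ℝ φ S y).adjoint (φ z)) S y :=
      (hasGradientWithinAt_inner_left (hφ y hyS) (φ z)).congr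
        (fun y' hy' => (hk y' hy' z hz).symm) (hk y hyS z hz).symm
    rw [hg.gradientWithin_eq (hS y hyS), ContinuousLinearMap.adjoint_inner_right,
      inner_add_right, inner_smul_right, ← hk y hyS z hz, real_inner_comm (φ z),
      real_inner_comm (φ z)]
  · rw [inner_sum]
    refine Finset.sum_eq_zero fun y hy => ?_
    rw [inner_add_right, inner_smul_right, real_inner_comm, (hh y hy).1,
      ← ContinuousLinearMap.adjoint_inner_left, (hh y hy).2]
    simp

omit [CompleteSpace H] in
theorem norm_sub_le_of_inner_sub_eq_zero {w σ : H} (h : ⟪w - σ, σ⟫ = 0) : ‖w - σ‖ ≤ ‖w‖ := by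
  have h1 := norm_add_sq_real (w - σ) σ
  rw [sub_add_cancel, h] at h1
  apply le_of_sq_le_sq _ (norm_nonneg _)
  nlinarith [sq_nonneg ‖σ‖]

/-- `w - σ` has zero Hermite data on `X`, so it is orthogonal to `σ` and Pythagoras applies. This
bound makes the final constant uniform over all interpolants. -/
theorem norm_residual_le {φ : E → H} {S : Set E} (hS : UniqueDiffOn ℝ S)
    (hφ : DifferentiableOn ℝ φ S) {k : E → E → ℝ} (hk : ∀ x ∈ S, ∀ y ∈ S, ⟪φ x, φ y⟫ = k x y)
    {v : E → ℝ} {dv : E → E} {X : Finset E} (hX : (X : Set E) ⊆ S) {s : E → ℝ}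
    (hs : IsHermiteInterpolant k S v dv X s) {w : H}
    (hw : ∀ x ∈ X, ⟪φ x, w⟫ = v x ∧ (fderivWithin ℝ φ S x).adjoint w = dv x) :
    ∃ σ : H, (∀ z ∈ S, s z = ⟪φ z, σ⟫) ∧ ‖w - σ‖ ≤ ‖w‖ := by
  obtain ⟨σ, h1, h2⟩ := exists_hermiteInterpolant_repr hS hφ hk hX hs
  refine ⟨σ, h1, norm_sub_le_of_inner_sub_eq_zero (h2 _ fun y hy => ?_)⟩
  obtain ⟨h3, h4⟩ := hs.2 y hy
  have hyS := hX hy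
  have h5 : gradientWithin s S y = (fderivWithin ℝ φ S y).adjoint σ :=
    ((hasGradientWithinAt_inner_left (hφ y hyS) σ).congr h1 (h1 y hyS)).gradientWithin_eq
      (hS y hyS)
  constructor
  · rw [inner_sub_right, (hw y hy).1, ← h1 y hyS, h3, sub_self]
  · rw [map_sub, (hw y hy).2, ← h5, h4, sub_self]

/-- The Hermite residual of an element of the feature space changes by at most a constant multiple
of the distance of the points, the constant being independent of the interpolant. -/
theorem hermiteError_le_add {φ : E → H} {S : Set E} (hS : UniqueDiffOn ℝ S)
    (hφ : DifferentiableOn ℝ φ S) {v : E → ℝ} {dv : E → E} {Q : Set E} (hQS : Q ⊆ S)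
    {L L' : ℝ} (hL : ∀ x ∈ Q, ∀ y ∈ Q, ‖φ x - φ y‖ ≤ L * ‖x - y‖)
    (hL' : ∀ x ∈ Q, ∀ y ∈ Q, ‖fderivWithin ℝ φ S x - fderivWithin ℝ φ S y‖ ≤ L' * ‖x - y‖)
    {w σ : H} (hw : ∀ x ∈ Q, ⟪φ x, w⟫ = v x ∧ (fderivWithin ℝ φ S x).adjoint w = dv x)
    {s : E → ℝ} (hs : ∀ z ∈ S, s z = ⟪φ z, σ⟫) {x y : E} (hx : x ∈ Q) (hy : y ∈ Q) :
    hermiteError S v dv s x ≤ hermiteError S v dv s y + ‖w - σ‖ * (L + L') * ‖x - y‖ := by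
  have h1 : ∀ z ∈ Q, v z - s z = ⟪φ z, w - σ⟫ := fun z hz => by
    rw [inner_sub_right, (hw z hz).1, hs z (hQS hz)]
  have h2 : ∀ z ∈ Q, dv z - gradientWithin s S z = (fderivWithin ℝ φ S z).adjoint (w - σ) :=
    fun z hz => by
      rw [map_sub, (hw z hz).2, ((hasGradientWithinAt_inner_left (hφ z (hQS hz)) σ).congr hs
        (hs z (hQS hz))).gradientWithin_eq (hS z (hQS hz))]
  have h3 : |v x - s x| ≤ |v y - s y| + L * ‖x - y‖ * ‖w - σ‖ := by
    have : v x - s x = (v y - s y) + ⟪φ x - φ y, w - σ⟫ := by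
      rw [h1 x hx, h1 y hy, inner_sub_left]; ring
    rw [this]
    refine (abs_add_le _ _).trans (add_le_add_right ?_ _)
    exact (abs_real_inner_le_norm _ _).trans
      (mul_le_mul_of_nonneg_right (hL x hx y hy) (norm_nonneg _))
  have h4 : ‖dv x - gradientWithin s S x‖ ≤
      ‖dv y - gradientWithin s S y‖ + L' * ‖x - y‖ * ‖w - σ‖ := by
    have : dv x - gradientWithin s S x = (dv y - gradientWithin s S y) +
        (fderivWithin ℝ φ S x - fderivWithin ℝ φ S y).adjoint (w - σ) := by
      rw [h2 x hx, h2 y hy, map_sub]; simp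
    rw [this]
    refine (norm_add_le _ _).trans (add_le_add_right ?_ _)
    refine (ContinuousLinearMap.le_opNorm _ _).trans ?_
    rw [LinearIsometryEquiv.norm_map]
    exact mul_le_mul_of_nonneg_right (hL' x hx y hy) (norm_nonneg _)
  simp only [hermiteError]
  linarith

theorem HermiteVKOGA.eq_zero_or_isHermiteInterpolant {k : E → E → ℝ} {S : Set E} {v : E → ℝ}
    {dv : E → E} {D : Set E} {tol : ℝ} {X : Finset E} {s : E → ℝ}
    (h : HermiteVKOGA k S v dv D tol X s) :
    (X : Set E) ⊆ D ∧ ((X = ∅ ∧ s = 0) ∨ IsHermiteInterpolant k S v dv X s) := by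
  induction h with
  | init => simp
  | step _ mem _ _ centers interpolant ih =>
    refine ⟨?_, Or.inr interpolant⟩
    rw [centers]
    exact insert_subset mem.1 ih.1

/-- The kernel functions of a reproducing kernel Hilbert space on `S`, extended by zero. -/
noncomputable def featureMap {E : Type*} (S : Set E) (H : Type*) [NormedAddCommGroup H] [InnerProductSpace ℝ H]
    [CompleteSpace H] [RKHS ℝ H S ℝ] (x : E) : H :=
  open Classical in if hx : x ∈ S then RKHS.kerFun H (⟨x, hx⟩ : S) (1 : ℝ) else 0

omit [NormedAddCommGroup E] [InnerProductSpace ℝ E] [CompleteSpace E] in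
theorem inner_featureMap_left {S : Set E} [RKHS ℝ H S ℝ] {x : E} (hx : x ∈ S) (h : H) :
    ⟪featureMap S H x, h⟫ = extendZero (h : S → ℝ) x := by
  have e : extendZero (h : S → ℝ) x = h ⟨x, hx⟩ :=
    Subtype.val_injective.extend_apply (h : S → ℝ) 0 ⟨x, hx⟩
  rw [e, featureMap, dif_pos hx, RKHS.kerFun_inner]
  simp

omit [NormedAddCommGroup E] [InnerProductSpace ℝ E] [CompleteSpace E] in
theorem inner_featureMap_featureMap {S : Set E} [RKHS ℝ H S ℝ] {k : E → E → ℝ}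
    (hH : ∀ x y : S, RKHS.kernel H x y (1 : ℝ) = k x y) {x y : E} (hx : x ∈ S) (hy : y ∈ S) :
    ⟪featureMap S H x, featureMap S H y⟫ = k x y := by
  rw [featureMap, featureMap, dif_pos hx, dif_pos hy, real_inner_comm, ← RKHS.kernel_inner,
    hH ⟨x, hx⟩ ⟨y, hy⟩]
  simp

end HermiteInterpolation

/-! ### Dynamic programming along trajectories. -/

noncomputable section

theorem ae_hasDerivAt_integral_of_pos {F : Type*} [NormedAddCommGroup F] [NormedSpace ℝ F]
    [CompleteSpace F] {φ : ℝ → F} (h : ∀ t : ℝ, 0 ≤ t → IntervalIntegrable φ volume 0 t) :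
    ∀ᵐ t : ℝ, 0 < t → HasDerivAt (fun t => ∫ s in (0 : ℝ)..t, φ s) (φ t) t := by
  have h1 : ∀ n : ℕ, ∀ᵐ t : ℝ, t ∈ uIcc (0 : ℝ) n → ∀ c ∈ uIcc (0 : ℝ) n,
      HasDerivAt (fun x => ∫ s in c..x, φ s) (φ t) t := fun n =>
    (h n n.cast_nonneg).ae_hasDerivAt_integral
  filter_upwards [ae_all_iff.2 h1] with t ht ht0
  obtain ⟨n, hn⟩ := exists_nat_ge t
  refine ht n ?_ 0 left_mem_uIcc
  rw [uIcc_of_le n.cast_nonneg]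
  exact ⟨ht0.le, hn⟩

namespace ControlProblem

variable {N M : ℕ} (P : ControlProblem N M)

/-- The integrand of the cost as a function of state and control. -/
def runningCost (x : EuclideanSpace ℝ (Fin N)) (u : EuclideanSpace ℝ (Fin M)) : ℝ :=
  P.r x + u.ofLp ⬝ᵥ (P.R *ᵥ u.ofLp)

theorem cost_eq_lintegral (x : ℝ → EuclideanSpace ℝ (Fin N)) (u : ℝ → EuclideanSpace ℝ (Fin M)) :
    P.cost x u = ∫⁻ s in Ici (0 : ℝ), ENNReal.ofReal (P.runningCost (x s) (u s)) := rfl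

/-- The weight matrix of the control as an operator. -/
def weight : EuclideanSpace ℝ (Fin M) →L[ℝ] EuclideanSpace ℝ (Fin M) :=
  Matrix.toEuclideanCLM (𝕜 := ℝ) P.R

theorem dotProduct_mulVec_eq_inner (a b : EuclideanSpace ℝ (Fin M)) :
    a.ofLp ⬝ᵥ (P.R *ᵥ b.ofLp) = ⟪a, P.weight b⟫ := by
  rw [EuclideanSpace.inner_eq_star_dotProduct, dotProduct_comm]
  simp [weight]

theorem runningCost_eq (x : EuclideanSpace ℝ (Fin N)) (u : EuclideanSpace ℝ (Fin M)) :
    P.runningCost x u = P.r x + ⟪u, P.weight u⟫ := by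
  rw [runningCost, dotProduct_mulVec_eq_inner]

theorem inner_weight_comm (a b : EuclideanSpace ℝ (Fin M)) :
    ⟪a, P.weight b⟫ = ⟪b, P.weight a⟫ := by
  have h : P.R.IsSymm := by simpa using P.R_posDef.isHermitian
  rw [← dotProduct_mulVec_eq_inner, ← dotProduct_mulVec_eq_inner, Matrix.dotProduct_mulVec,
    ← Matrix.mulVec_transpose, h.eq, dotProduct_comm]

theorem inner_weight_nonneg (a : EuclideanSpace ℝ (Fin M)) : 0 ≤ ⟪a, P.weight a⟫ := by
  rw [← dotProduct_mulVec_eq_inner]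
  simpa using P.R_posDef.posSemidef.dotProduct_mulVec_nonneg a.ofLp

theorem runningCost_nonneg (x : EuclideanSpace ℝ (Fin N)) (u : EuclideanSpace ℝ (Fin M)) :
    0 ≤ P.runningCost x u := by
  rw [runningCost_eq]
  exact add_nonneg (P.r_nonneg x) (P.inner_weight_nonneg u)

variable {P} {x₀ : EuclideanSpace ℝ (Fin N)} {x : ℝ → EuclideanSpace ℝ (Fin N)}
  {u : ℝ → EuclideanSpace ℝ (Fin M)}

theorem IsAdmissible.initial (h : P.IsAdmissible x₀ x u) : x 0 = x₀ := by
  simpa using h.eq_integral 0 le_rfl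

theorem IsAdmissible.continuousOn (h : P.IsAdmissible x₀ x u) : ContinuousOn x (Ici 0) := by
  intro t ht
  have ht' : (0 : ℝ) ≤ t + 1 := add_nonneg ht zero_le_one
  have h1 : ContinuousOn x (Icc 0 (t + 1)) := by
    have := intervalIntegral.continuousOn_primitive_interval' (h.intervalIntegrable (t + 1) ht')
      left_mem_uIcc
    rw [uIcc_of_le ht'] at this
    exact (this.const_add x₀).congr fun s hs => h.eq_integral s hs.1
  refine (h1 t ⟨ht, by linarith⟩).mono_of_mem_nhdsWithin ?_
  rw [← Ici_inter_Iic]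
  exact inter_mem_nhdsWithin _ (Iic_mem_nhds (lt_add_one t))

theorem IsAdmissible.sub_eq_integral (h : P.IsAdmissible x₀ x u) {τ t : ℝ} (hτ : 0 ≤ τ)
    (ht : 0 ≤ t) : x t - x τ = ∫ s in τ..t, (P.f (x s) + P.g (x s) (u s)) := by
  rw [h.eq_integral t ht, h.eq_integral τ hτ, add_sub_add_left_eq_sub,
    intervalIntegral.integral_interval_sub_left (h.intervalIntegrable t ht)
      (h.intervalIntegrable τ hτ)]

theorem IsAdmissible.shift (h : P.IsAdmissible x₀ x u) {τ : ℝ} (hτ : 0 ≤ τ) :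
    P.IsAdmissible (x τ) (fun t => x (τ + t)) (fun t => u (τ + t)) where
  measurable_control := h.measurable_control.comp (measurable_const_add τ)
  intervalIntegrable t ht := by
    have := ((h.intervalIntegrable τ hτ).symm.trans
      (h.intervalIntegrable (τ + t) (add_nonneg hτ ht))).comp_add_left τ
    simpa using this
  eq_integral t ht := by
    rw [intervalIntegral.integral_comp_add_left (fun s => P.f (x s) + P.g (x s) (u s)), add_zero,
      ← h.sub_eq_integral hτ (add_nonneg hτ ht)]
    abel

theorem setLIntegral_Ici_eq_add (φ : ℝ → ℝ≥0∞) {τ : ℝ} (hτ : 0 ≤ τ) :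
    ∫⁻ s in Ici 0, φ s = (∫⁻ s in Icc 0 τ, φ s) + ∫⁻ s in Ioi 0, φ (τ + s) := by
  rw [← Icc_union_Ioi_eq_Ici hτ, lintegral_union measurableSet_Ioi
    (disjoint_left.2 fun a ha hb => not_lt.2 ha.2 hb)]
  congr 1
  have := (measurePreserving_add_left volume τ).setLIntegral_comp_preimage_emb
    (measurableEmbedding_addLeft τ) φ (Ioi τ)
  rw [← this]
  simp

theorem cost_eq_add (x : ℝ → EuclideanSpace ℝ (Fin N)) (u : ℝ → EuclideanSpace ℝ (Fin M))
    {τ : ℝ} (hτ : 0 ≤ τ) : P.cost x u =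
      (∫⁻ s in Icc 0 τ, ENNReal.ofReal (P.runningCost (x s) (u s))) +
        P.cost (fun t => x (τ + t)) (fun t => u (τ + t)) := by
  rw [cost_eq_lintegral, setLIntegral_Ici_eq_add _ hτ, cost_eq_lintegral,
    setLIntegral_congr Ioi_ae_eq_Ici]

theorem value_le_cost (h : P.IsAdmissible x₀ x u) : P.value x₀ ≤ P.cost x u :=
  iInf_le_of_le x (iInf_le_of_le u (iInf_le_of_le h le_rfl))

/-- The first piece need only solve the equation on `[0, τ]`, so that a merely local solution with
constant control can be continued by an arbitrary process. -/
theorem IsAdmissible.concat {x' : ℝ → EuclideanSpace ℝ (Fin N)}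
    {u' : ℝ → EuclideanSpace ℝ (Fin M)} {τ : ℝ} (hτ : 0 ≤ τ) (hu : Measurable u)
    (hint : IntervalIntegrable (fun s => P.f (x s) + P.g (x s) (u s)) volume 0 τ)
    (hx : ∀ t ∈ Icc 0 τ, x t = x₀ + ∫ s in (0 : ℝ)..t, (P.f (x s) + P.g (x s) (u s)))
    (h' : P.IsAdmissible (x τ) x' u') :
    P.IsAdmissible x₀ (fun t => if t ≤ τ then x t else x' (t - τ))
      (fun t => if t ≤ τ then u t else u' (t - τ)) := by
  set φ : ℝ → EuclideanSpace ℝ (Fin N) := fun s => P.f (x s) + P.g (x s) (u s)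
  set φ' : ℝ → EuclideanSpace ℝ (Fin N) := fun s => P.f (x' s) + P.g (x' s) (u' s)
  set X : ℝ → EuclideanSpace ℝ (Fin N) := fun t => if t ≤ τ then x t else x' (t - τ)
  set U : ℝ → EuclideanSpace ℝ (Fin M) := fun t => if t ≤ τ then u t else u' (t - τ)
  set Φ : ℝ → EuclideanSpace ℝ (Fin N) := fun s => P.f (X s) + P.g (X s) (U s)
  have e1 : ∀ t, t ≤ τ → Φ t = φ t := fun t ht => by simp [Φ, X, U, φ, ht]
  have e2 : ∀ t, τ < t → Φ t = φ' (t - τ) := fun t ht => by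
    simp [Φ, X, U, φ', not_le.2 ht]
  have i1 : ∀ t ∈ Icc 0 τ, IntervalIntegrable Φ volume 0 t := fun t ht => by
    refine (hint.mono_set ?_).congr fun s hs => (e1 s ?_).symm
    · rw [uIcc_of_le ht.1, uIcc_of_le hτ]; exact Icc_subset_Icc_right ht.2
    · rw [uIoc_of_le ht.1] at hs; exact hs.2.trans ht.2
  have j1 : ∀ t ∈ Icc 0 τ, ∫ s in (0 : ℝ)..t, Φ s = ∫ s in (0 : ℝ)..t, φ s := fun t ht =>
    intervalIntegral.integral_congr fun s hs => e1 s (by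
      rw [uIcc_of_le ht.1] at hs; exact hs.2.trans ht.2)
  have i2 : ∀ t, τ ≤ t → IntervalIntegrable Φ volume τ t := fun t ht => by
    have := (h'.intervalIntegrable (t - τ) (sub_nonneg.2 ht)).comp_sub_right τ
    rw [zero_add, sub_add_cancel] at this
    refine this.congr fun s hs => (e2 s ?_).symm
    rw [uIoc_of_le ht] at hs; exact hs.1
  have j2 : ∀ t, τ ≤ t → ∫ s in τ..t, Φ s = ∫ s in (0 : ℝ)..(t - τ), φ' s := fun t ht => by
    have := intervalIntegral.integral_comp_sub_right (a := τ) (b := t) φ' τ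
    rw [sub_self] at this
    rw [← this]
    refine intervalIntegral.integral_congr_ae (Eventually.of_forall fun s hs => e2 s ?_)
    rw [uIoc_of_le ht] at hs; exact hs.1
  refine ⟨Measurable.ite measurableSet_Iic hu
    (h'.measurable_control.comp (measurable_sub_const τ)), fun t ht => ?_, fun t ht => ?_⟩
  · rcases le_total t τ with h | h
    · exact i1 t ⟨ht, h⟩
    · exact (i1 τ ⟨hτ, le_rfl⟩).trans (i2 t h)
  · rcases le_or_gt t τ with h | h
    · change X t = x₀ + ∫ s in (0 : ℝ)..t, Φ s
      rw [j1 t ⟨ht, h⟩, ← hx t ⟨ht, h⟩]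
      simp [X, h]
    · change X t = x₀ + ∫ s in (0 : ℝ)..t, Φ s
      rw [← intervalIntegral.integral_add_adjacent_intervals (i1 τ ⟨hτ, le_rfl⟩) (i2 t h.le),
        j1 τ ⟨hτ, le_rfl⟩, j2 t h.le, ← add_assoc, ← hx τ ⟨hτ, le_rfl⟩,
        ← h'.eq_integral (t - τ) (sub_nonneg.2 h.le)]
      simp [X, not_le.2 h]

/-- The inequality in Bellman's principle: following a trajectory for a time and then any
process is not better than the value. -/
theorem value_le_add {τ : ℝ} (hτ : 0 ≤ τ) (hu : Measurable u)
    (hint : IntervalIntegrable (fun s => P.f (x s) + P.g (x s) (u s)) volume 0 τ)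
    (hx : ∀ t ∈ Icc 0 τ, x t = x₀ + ∫ s in (0 : ℝ)..t, (P.f (x s) + P.g (x s) (u s))) :
    P.value x₀ ≤
      (∫⁻ s in Icc 0 τ, ENNReal.ofReal (P.runningCost (x s) (u s))) + P.value (x τ) := by
  rw [← tsub_le_iff_left]
  refine le_iInf fun x' => le_iInf fun u' => le_iInf fun h' => ?_
  rw [tsub_le_iff_left]
  refine (value_le_cost (IsAdmissible.concat hτ hu hint hx h')).trans_eq ?_
  rw [cost_eq_lintegral, setLIntegral_Ici_eq_add _ hτ, cost_eq_lintegral,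
    ← setLIntegral_congr (Ioi_ae_eq_Ici (a := (0 : ℝ)))]
  congr 1
  · refine setLIntegral_congr_fun measurableSet_Icc fun s hs => ?_
    simp [hs.2]
  · refine setLIntegral_congr_fun measurableSet_Ioi fun s hs => ?_
    have : ¬ s ≤ 0 := not_le.2 hs
    simp [this]

theorem IsOptimal.value_eq_add (h : P.IsOptimal x₀ x u) {τ : ℝ} (hτ : 0 ≤ τ) :
    P.value x₀ =
      (∫⁻ s in Icc 0 τ, ENNReal.ofReal (P.runningCost (x s) (u s))) + P.value (x τ) := by
  refine le_antisymm (value_le_add hτ h.1.measurable_control (h.1.intervalIntegrable τ hτ)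
    fun t ht => h.1.eq_integral t ht.1) ?_
  rw [← h.2, cost_eq_add x u hτ]
  gcongr
  exact value_le_cost (h.1.shift hτ)

theorem IsAdmissible.aestronglyMeasurable_runningCost (h : P.IsAdmissible x₀ x u) :
    AEStronglyMeasurable (fun s => P.runningCost (x s) (u s)) (volume.restrict (Ici 0)) := by
  simp_rw [runningCost_eq]
  refine AEStronglyMeasurable.add ?_ ?_
  · exact (P.r_continuous.comp_continuousOn h.continuousOn).aestronglyMeasurable measurableSet_Ici
  · have hu := h.measurable_control.stronglyMeasurable
    exact (hu.inner (P.weight.continuous.comp_stronglyMeasurable hu)).aestronglyMeasurable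

theorem IsOptimal.integrableOn_runningCost (h : P.IsOptimal x₀ x u) (hv : P.value x₀ ≠ ⊤) :
    IntegrableOn (fun s => P.runningCost (x s) (u s)) (Ici 0) := by
  refine ⟨h.1.aestronglyMeasurable_runningCost, ?_⟩
  rw [hasFiniteIntegral_iff_ofReal (Eventually.of_forall fun s => P.runningCost_nonneg _ _)]
  exact lt_top_iff_ne_top.2 (by rw [← cost_eq_lintegral, h.2]; exact hv)

theorem IsOptimal.value_le (h : P.IsOptimal x₀ x u) {t : ℝ} (ht : 0 ≤ t) :
    P.value (x t) ≤ P.value x₀ := by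
  rw [h.value_eq_add ht]
  exact le_add_self

theorem IsOptimal.valueReal_eq (h : P.IsOptimal x₀ x u) (hv : P.value x₀ ≠ ⊤) {t : ℝ}
    (ht : 0 ≤ t) :
    P.valueReal (x t) = P.valueReal x₀ - ∫ s in (0 : ℝ)..t, P.runningCost (x s) (u s) := by
  have h1 := h.value_eq_add ht
  have h2 : ∫⁻ s in Icc 0 t, ENNReal.ofReal (P.runningCost (x s) (u s)) ≠ ⊤ :=
    ne_top_of_le_ne_top hv (h1 ▸ le_self_add)
  have h3 : P.value (x t) ≠ ⊤ := ne_top_of_le_ne_top hv (h.value_le ht)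
  rw [valueReal, valueReal, h1, ENNReal.toReal_add h2 h3, intervalIntegral.integral_of_le ht,
    ← integral_Icc_eq_integral_Ioc, integral_eq_lintegral_of_nonneg_ae
      (Eventually.of_forall fun s => P.runningCost_nonneg _ _)
      (h.1.aestronglyMeasurable_runningCost.mono_set Icc_subset_Ici_self)]
  ring

end ControlProblem

theorem nonneg_of_hasDerivAt_of_eventually_le {G : ℝ → ℝ} {d a : ℝ} (hG : HasDerivAt G d a)
    (h : ∀ᶠ t in 𝓝[>] a, G a ≤ G t) : 0 ≤ d := by
  have h1 : Tendsto (slope G a) (𝓝[>] a) (𝓝 d) := (hasDerivAt_iff_tendsto_slope.1 hG).mono_left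
    (nhdsWithin_mono a fun t (ht : a < t) => ht.ne')
  refine ge_of_tendsto h1 ?_
  filter_upwards [h, self_mem_nhdsWithin] with t ht hat
  rw [slope_def_field]
  exact div_nonneg (sub_nonneg.2 ht) (sub_nonneg.2 (le_of_lt hat))

/-! ### The Hamilton–Jacobi–Bellman equation. -/

namespace ControlProblem

variable {N M : ℕ} {P : ControlProblem N M} {x₀ : EuclideanSpace ℝ (Fin N)}
  {x : ℝ → EuclideanSpace ℝ (Fin N)} {u : ℝ → EuclideanSpace ℝ (Fin M)}

/-- The Hamilton–Jacobi–Bellman inequality at a point of differentiability of the value function. -/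
theorem hamiltonian_nonneg_of_hasGradientAt {p : EuclideanSpace ℝ (Fin N)}
    (hf : ContDiffAt ℝ 1 P.f x₀) (hg : ContDiffAt ℝ 1 P.g x₀)
    (hfin : ∀ᶠ y in 𝓝 x₀, P.value y ≠ ⊤) (hv : HasGradientAt P.valueReal p x₀)
    (a : EuclideanSpace ℝ (Fin M)) :
    0 ≤ ⟪p, P.f x₀ + P.g x₀ a⟫ + P.runningCost x₀ a := by
  set F : EuclideanSpace ℝ (Fin N) → EuclideanSpace ℝ (Fin N) := fun z => P.f z + P.g z a
  have hF : ContDiffAt ℝ 1 F x₀ := hf.add (hg.clm_apply contDiffAt_const)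
  -- Picard–Lindelöf for the dynamics with the control frozen at `a`.
  obtain ⟨α, hα0, ε, hε, hα⟩ :=
    hF.exists_forall_mem_closedBall_exists_eq_forall_mem_Ioo_hasDerivAt₀ 0
  rw [zero_sub, zero_add] at hα
  have hFc : ∀ᶠ y in 𝓝 x₀, ContinuousAt F y :=
    (hF.eventually (by simp)).mono fun y hy => hy.continuousAt
  have hαc : ContinuousAt α 0 := (hα 0 ⟨neg_lt_zero.2 hε, hε⟩).continuousAt
  have hev : ∀ᶠ t in 𝓝 (0 : ℝ), P.value (α t) ≠ ⊤ ∧ ContinuousAt F (α t) := by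
    rw [ContinuousAt, hα0] at hαc
    exact hαc.eventually (hfin.and hFc)
  obtain ⟨ε', hε', hball⟩ := Metric.eventually_nhds_iff_ball.1 hev
  rw [Real.ball_eq_Ioo, zero_sub, zero_add] at hball
  set η := min ε ε'
  have hη : 0 < η := lt_min hε hε'
  have hαη : ∀ t ∈ Ioo (-η) η, HasDerivAt α (F (α t)) t := fun t ht =>
    hα t ⟨by linarith [ht.1, min_le_left ε ε'], ht.2.trans_le (min_le_left _ _)⟩
  have hη' : ∀ t ∈ Ioo (-η) η, P.value (α t) ≠ ⊤ ∧ ContinuousAt F (α t) := fun t ht =>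
    hball t ⟨by linarith [ht.1, min_le_right ε ε'], ht.2.trans_le (min_le_right _ _)⟩
  have hr : ContinuousOn (fun t => P.runningCost (α t) a) (Ioo (-η) η) := by
    simp only [runningCost]
    refine ContinuousOn.add (P.r_continuous.comp_continuousOn fun t ht => ?_) continuousOn_const
    exact (hαη t ht).continuousAt.continuousWithinAt
  have hsub : ∀ t, 0 ≤ t → t < η → Icc 0 t ⊆ Ioo (-η) η := fun t _ ht s hs =>
    ⟨(neg_lt_zero.2 hη).trans_le hs.1, hs.2.trans_lt ht⟩
  have hFα : ContinuousOn (fun t => F (α t)) (Ioo (-η) η) := fun t ht =>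
    ((hη' t ht).2.comp (f := α) (hαη t ht).continuousAt).continuousWithinAt
  -- Bellman's inequality says `G 0 ≤ G t` for small `t > 0`; the derivative of `G` at `0` is the
  -- expression to be bounded.
  set G : ℝ → ℝ := fun t => (∫ s in (0 : ℝ)..t, P.runningCost (α s) a) + P.valueReal (α t)
  have h0 : (0 : ℝ) ∈ Ioo (-η) η := ⟨neg_lt_zero.2 hη, hη⟩
  have hG : HasDerivAt G (P.runningCost x₀ a + ⟪p, F x₀⟫) 0 := by
    refine HasDerivAt.add ?_ ?_
    · have := intervalIntegral.integral_hasDerivAt_right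
        (f := fun s => P.runningCost (α s) a) (a := 0) (b := 0) (by simp)
        (hr.stronglyMeasurableAtFilter isOpen_Ioo 0 h0) (hr.continuousAt (isOpen_Ioo.mem_nhds h0))
      rwa [hα0] at this
    · rw [← hα0] at hv
      have := hv.hasFDerivAt.comp_hasDerivAt 0 (hαη 0 h0)
      simpa [hα0] using! this
  have hGle : ∀ᶠ t in 𝓝[>] (0 : ℝ), G 0 ≤ G t := by
    filter_upwards [self_mem_nhdsWithin, nhdsWithin_le_nhds (Iio_mem_nhds hη)] with t ht0 htη
    have ht0' : (0 : ℝ) ≤ t := le_of_lt ht0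
    have hsubt := hsub t ht0' htη
    have hint : ∀ s ∈ Icc 0 t, IntervalIntegrable (fun s => F (α s)) volume 0 s := fun s hs =>
      (hFα.mono (by
        rw [uIcc_of_le hs.1]; exact (Icc_subset_Icc_right hs.2).trans hsubt)).intervalIntegrable
    have hDP := value_le_add (P := P) (x₀ := x₀) (x := α) (u := fun _ => a) ht0'
      measurable_const (hint t ⟨ht0', le_rfl⟩) (fun s hs => by
        have := intervalIntegral.integral_eq_sub_of_hasDerivAt (f := α)
          (f' := fun s => F (α s)) (a := 0) (b := s)
          (fun τ hτ => hαη τ (hsubt (Icc_subset_Icc_right hs.2 (by rwa [uIcc_of_le hs.1] at hτ))))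
          (hint s hs)
        change α s = x₀ + ∫ τ in (0 : ℝ)..s, F (α τ)
        rw [this, hα0]; abel)
    have hvt : P.value (α t) ≠ ⊤ := (hη' t (hsubt ⟨ht0', le_rfl⟩)).1
    have hrt := hr.mono hsubt
    have hI : IntegrableOn (fun s => P.runningCost (α s) a) (Icc 0 t) :=
      hrt.integrableOn_Icc
    have hIeq := ofReal_integral_eq_lintegral_ofReal hI
      (Eventually.of_forall fun s => P.runningCost_nonneg _ _)
    rw [← hIeq] at hDP
    have hreal := ENNReal.toReal_mono (ENNReal.add_ne_top.2 ⟨ENNReal.ofReal_ne_top, hvt⟩) hDP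
    rw [ENNReal.toReal_add ENNReal.ofReal_ne_top hvt, ENNReal.toReal_ofReal
      (integral_nonneg fun s => P.runningCost_nonneg _ _), integral_Icc_eq_integral_Ioc,
      ← intervalIntegral.integral_of_le ht0'] at hreal
    simp only [G, intervalIntegral.integral_same, zero_add, hα0]
    exact hreal
  have := nonneg_of_hasDerivAt_of_eventually_le hG hGle
  linarith

/-- At points in the closure of the interior, `dv` is only a continuous extension, so the inequality
is passed to the limit from interior points. -/
theorem HasC1ValueOn.hamiltonian_nonneg {Ω : Set (EuclideanSpace ℝ (Fin N))}
    {dv : EuclideanSpace ℝ (Fin N) → EuclideanSpace ℝ (Fin N)} (h : P.HasC1ValueOn Ω dv)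
    (hf : ∀ x ∈ Ω, ContDiffAt ℝ 1 P.f x) (hg : ∀ x ∈ Ω, ContDiffAt ℝ 1 P.g x)
    {y : EuclideanSpace ℝ (Fin N)} (hy : y ∈ Ω) (a : EuclideanSpace ℝ (Fin M)) :
    0 ≤ ⟪dv y, P.f y + P.g y a⟫ + P.runningCost y a := by
  have key : ∀ z ∈ Ω, z ∈ interior Ω ∨ z ∉ closure (interior Ω) →
      0 ≤ ⟪dv z, P.f z + P.g z a⟫ + P.runningCost z a := fun z hz hz' =>
    hamiltonian_nonneg_of_hasGradientAt (hf z hz) (hg z hz) (h.hasGradientAt z hz hz').1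
      (h.hasGradientAt z hz hz').2 a
  by_cases hc : y ∈ closure (interior Ω)
  · have hcont : ContinuousWithinAt
        (fun z => ⟪dv z, P.f z + P.g z a⟫ + P.runningCost z a) Ω y := by
      refine ((h.continuousOn_gradient y hy).inner ?_).add ?_
      · exact ((hf y hy).continuousAt.add
          ((hg y hy).continuousAt.clm_apply continuousAt_const)).continuousWithinAt
      · exact (P.r_continuous.continuousAt.add continuousAt_const).continuousWithinAt
    have := mem_closure_iff_nhdsWithin_neBot.1 hc
    refine ge_of_tendsto (hcont.mono interior_subset) ?_
    filter_upwards [self_mem_nhdsWithin] with z hz using key z (interior_subset hz) (Or.inl hz)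
  · exact key y hy (Or.inr hc)

/-- Along an optimal trajectory that stays in a set on which the value function has the gradient
`dv`, equality holds in the Hamilton–Jacobi–Bellman inequality almost everywhere. -/
theorem IsOptimal.ae_hamiltonian_eq_zero (h : P.IsOptimal x₀ x u) (hv : P.value x₀ ≠ ⊤)
    {Ω : Set (EuclideanSpace ℝ (Fin N))}
    {dv : EuclideanSpace ℝ (Fin N) → EuclideanSpace ℝ (Fin N)}
    (hdv : ∀ y ∈ Ω, HasGradientWithinAt P.valueReal (dv y) Ω y) (hx : ∀ t, 0 ≤ t → x t ∈ Ω) :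
    ∀ᵐ t : ℝ, 0 < t →
      ⟪dv (x t), P.f (x t) + P.g (x t) (u t)⟫ + P.runningCost (x t) (u t) = 0 := by
  have h1 := ae_hasDerivAt_integral_of_pos h.1.intervalIntegrable
  have h2 := ae_hasDerivAt_integral_of_pos
    (φ := fun s => P.runningCost (x s) (u s)) (fun t ht =>
      (intervalIntegrable_iff_integrableOn_Icc_of_le ht).2
        ((h.integrableOn_runningCost hv).mono_set Icc_subset_Ici_self))
  filter_upwards [h1, h2] with t ht1 ht2 ht0
  have hpos : ∀ᶠ s in 𝓝 t, 0 < s := Ioi_mem_nhds ht0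
  have d1 : HasDerivAt x (P.f (x t) + P.g (x t) (u t)) t :=
    ((ht1 ht0).const_add x₀).congr_of_eventuallyEq
      (hpos.mono fun s hs => h.1.eq_integral s hs.le)
  have d2 : HasDerivAt (fun s => P.valueReal (x s)) (-P.runningCost (x t) (u t)) t :=
    ((ht2 ht0).const_sub _).congr_of_eventuallyEq (hpos.mono fun s hs => h.valueReal_eq hv hs.le)
  have d3 : HasDerivWithinAt (fun s => P.valueReal (x s))
      ⟪dv (x t), P.f (x t) + P.g (x t) (u t)⟫ (Ioi 0) t := by
    have := (hdv (x t) (hx t ht0.le)).hasFDerivWithinAt.comp_hasDerivWithinAt t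
      (d1.hasDerivWithinAt (s := Ioi 0)) (fun s (hs : 0 < s) => hx s hs.le)
    simpa using! this
  have d4 := d3.hasDerivAt (Ioi_mem_nhds ht0)
  -- The value along the trajectory is differentiated both by the chain rule and as the remaining
  -- cost.
  rw [d4.unique d2]
  ring

end ControlProblem

/-- By Carathéodory, convex combinations of at most `dim E + 1` points suffice, so the hull is a
finite union of continuous images of compact sets. -/
theorem isCompact_convexHull_of_finiteDimensional {E : Type*} [NormedAddCommGroup E]
    [NormedSpace ℝ E] [FiniteDimensional ℝ E] {s : Set E} (hs : IsCompact s) :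
    IsCompact (convexHull ℝ s) := by
  have heq : convexHull ℝ s = ⋃ n ∈ Iic (Module.finrank ℝ E + 1),
      (fun q : (Fin n → ℝ) × (Fin n → E) => ∑ i, q.1 i • q.2 i) ''
        (stdSimplex ℝ (Fin n) ×ˢ univ.pi fun _ => s) := by
    ext x
    simp only [mem_iUnion, exists_prop]
    constructor
    · intro hx
      obtain ⟨ι, _, z, w, hz, hind, hw0, hw1, rfl⟩ := eq_pos_convex_span_of_mem_convexHull hx
      let e := Fintype.equivFin ι
      refine ⟨Fintype.card ι, ?_, (w ∘ e.symm, z ∘ e.symm), ⟨⟨fun i => (hw0 _).le, ?_⟩,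
        fun i _ => hz (mem_range_self _)⟩, ?_⟩
      · refine hind.card_le_finrank_succ.trans ?_
        exact Nat.succ_le_succ (Submodule.finrank_le _)
      · exact (e.symm.sum_comp w).trans hw1
      · exact e.symm.sum_comp fun i => w i • z i
    · rintro ⟨n, -, ⟨w, z⟩, ⟨⟨hw0, hw1⟩, hz⟩, rfl⟩
      exact (convex_convexHull ℝ s).sum_mem (fun i _ => hw0 i) hw1
        fun i _ => subset_convexHull ℝ s (hz i (mem_univ i))
  rw [heq]
  refine (finite_Iic _).isCompact_biUnion fun n _ => ?_
  refine ((isCompact_stdSimplex ℝ (Fin n)).prod (isCompact_univ_pi fun _ => hs)).image ?_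
  fun_prop

/-- The adjoint as a continuous real-linear map. -/
def realAdjoint (E F : Type*) [NormedAddCommGroup E] [InnerProductSpace ℝ E] [CompleteSpace E]
    [NormedAddCommGroup F] [InnerProductSpace ℝ F] [CompleteSpace F] :
    (E →L[ℝ] F) →L[ℝ] (F →L[ℝ] E) :=
  LinearMap.mkContinuous
    { toFun := fun T => T.adjoint
      map_add' := fun S T => map_add _ S T
      map_smul' := fun c T => by simp } 1 fun T => by simp

/-! ### The closed loop, the reachable set and the explored data. -/

namespace ControlProblem

variable {N M : ℕ} (P : ControlProblem N M)

/-- The inverse of the weight operator. -/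
def weightInv : EuclideanSpace ℝ (Fin M) →L[ℝ] EuclideanSpace ℝ (Fin M) :=
  Matrix.toEuclideanCLM (𝕜 := ℝ) P.R⁻¹

theorem weightInv_weight (a : EuclideanSpace ℝ (Fin M)) : P.weightInv (P.weight a) = a := by
  have h : P.weightInv * P.weight = 1 := by
    rw [weightInv, weight, ← map_mul,
      Matrix.nonsing_inv_mul _ ((Matrix.isUnit_iff_isUnit_det _).1 P.R_posDef.isUnit), map_one]
  exact DFunLike.congr_fun h a

/-- The control minimizing the Hamiltonian at the state `y` and costate `p`. -/
def feedback (y p : EuclideanSpace ℝ (Fin N)) : EuclideanSpace ℝ (Fin M) :=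
  -((1 / 2 : ℝ) • P.weightInv (realAdjoint _ _ (P.g y) p))

/-- The dynamics under the control minimizing the Hamiltonian. -/
def closedLoop (y p : EuclideanSpace ℝ (Fin N)) : EuclideanSpace ℝ (Fin N) :=
  P.f y + P.g y (P.feedback y p)

variable {P} {x₀ : EuclideanSpace ℝ (Fin N)} {x : ℝ → EuclideanSpace ℝ (Fin N)}
  {u : ℝ → EuclideanSpace ℝ (Fin M)}

/-- `b` minimizes a quadratic in the control, so its derivative vanishes: `g(y)ᵀ p + 2 R b = 0`,
which is solved for `b` by inverting `R`. -/
theorem eq_feedback_of_hamiltonian {y p : EuclideanSpace ℝ (Fin N)}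
    (h : ∀ a, 0 ≤ ⟪p, P.f y + P.g y a⟫ + P.runningCost y a) {b : EuclideanSpace ℝ (Fin M)}
    (hb : ⟪p, P.f y + P.g y b⟫ + P.runningCost y b = 0) : b = P.feedback y p := by
  have key : ∀ c, ⟪realAdjoint _ _ (P.g y) p + (2 : ℝ) • P.weight b, c⟫ = 0 := by
    intro c
    have hq : ∀ τ : ℝ, 0 ≤ τ * ⟪realAdjoint _ _ (P.g y) p + (2 : ℝ) • P.weight b, c⟫ +
        τ ^ 2 * ⟪c, P.weight c⟫ := by
      intro τ
      have h1 := h (b + τ • c)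
      have e0 : ⟪realAdjoint _ _ (P.g y) p, c⟫ = ⟪p, P.g y c⟫ :=
        ContinuousLinearMap.adjoint_inner_left _ _ _
      have e1 : ⟪P.weight b, c⟫ = ⟪c, P.weight b⟫ := real_inner_comm _ _
      rw [runningCost_eq] at h1 hb
      simp only [map_add, map_smul, inner_add_left, inner_add_right, inner_smul_left,
        inner_smul_right, conj_trivial] at h1 hb ⊢
      rw [P.inner_weight_comm b c] at h1
      rw [e0, e1]
      linarith
    set A := ⟪realAdjoint _ _ (P.g y) p + (2 : ℝ) • P.weight b, c⟫
    set B := ⟪c, P.weight c⟫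
    have hB : 0 ≤ B := P.inner_weight_nonneg c
    -- Any small step against the sign of `A` would do; `B + 1` avoids dividing by zero and makes
    -- the value `-(A ^ 2) / (B + 1) ^ 2`.
    have h1 := hq (-A / (B + 1))
    have h2 : -A / (B + 1) * A + (-A / (B + 1)) ^ 2 * B = -(A ^ 2) / (B + 1) ^ 2 := by
      field_simp; ring
    rw [h2, neg_div, neg_nonneg] at h1
    by_contra hA
    have : 0 < A ^ 2 / (B + 1) ^ 2 := by positivity
    linarith
  have h0 := inner_self_eq_zero.1 (key _)
  have h1 : P.weightInv (realAdjoint _ _ (P.g y) p) = -((2 : ℝ) • b) := by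
    rw [eq_neg_of_add_eq_zero_left h0, map_neg, map_smul, weightInv_weight]
  rw [feedback, h1, smul_neg, neg_neg, smul_smul]
  norm_num

theorem contDiffAt_closedLoop {y p : EuclideanSpace ℝ (Fin N)} (hf : ContDiffAt ℝ 1 P.f y)
    (hg : ContDiffAt ℝ 1 P.g y) :
    ContDiffAt ℝ 1 (fun q : EuclideanSpace ℝ (Fin N) × EuclideanSpace ℝ (Fin N) =>
      P.closedLoop q.1 q.2) (y, p) := by
  have hf' : ContDiffAt ℝ 1 (fun q : EuclideanSpace ℝ (Fin N) × EuclideanSpace ℝ (Fin N) =>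
      P.f q.1) (y, p) := ContDiffAt.comp (y, p) (g := P.f) (f := Prod.fst) hf contDiffAt_fst
  have hg' : ContDiffAt ℝ 1 (fun q : EuclideanSpace ℝ (Fin N) × EuclideanSpace ℝ (Fin N) =>
      P.g q.1) (y, p) := ContDiffAt.comp (y, p) (g := P.g) (f := Prod.fst) hg contDiffAt_fst
  unfold closedLoop feedback
  have hadj : ContDiffAt ℝ 1 (fun q : EuclideanSpace ℝ (Fin N) × EuclideanSpace ℝ (Fin N) =>
      realAdjoint (EuclideanSpace ℝ (Fin M)) (EuclideanSpace ℝ (Fin N)) (P.g q.1)) (y, p) :=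
    (realAdjoint (EuclideanSpace ℝ (Fin M))
      (EuclideanSpace ℝ (Fin N))).contDiff.contDiffAt.comp (y, p) hg'
  refine hf'.add (hg'.clm_apply (ContDiffAt.neg (ContDiffAt.const_smul _ ?_)))
  exact P.weightInv.contDiff.contDiffAt.comp (y, p) (hadj.clm_apply contDiffAt_snd)

theorem exists_lipschitzOnWith_closedLoop {Ω : Set (EuclideanSpace ℝ (Fin N))} (hΩ : IsCompact Ω)
    {dv : EuclideanSpace ℝ (Fin N) → EuclideanSpace ℝ (Fin N)}
    (hf : ∀ y ∈ Ω, ContDiffAt ℝ 1 P.f y) (hg : ∀ y ∈ Ω, ContDiffAt ℝ 1 P.g y) {L : NNReal}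
    (hdv : LipschitzOnWith L dv Ω) :
    ∃ K, LipschitzOnWith K (fun y => P.closedLoop y (dv y)) Ω := by
  apply LocallyLipschitzOn.exists_lipschitzOnWith_of_compact hΩ
  intro y hy
  obtain ⟨K, t, ht, hK⟩ :=
    (contDiffAt_closedLoop (p := dv y) (hf y hy) (hg y hy)).exists_lipschitzOnWith
  have hpair : LipschitzOnWith (max 1 L) (fun z => (z, dv z)) Ω :=
    (LipschitzWith.id.lipschitzOnWith (s := Ω)).prodMk hdv
  have hmem : (fun z => (z, dv z)) ⁻¹' t ∈ 𝓝[Ω] y := (hpair.continuousOn y hy) ht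
  have hcomp : LipschitzOnWith (K * max 1 L)
      ((fun q : EuclideanSpace ℝ (Fin N) × EuclideanSpace ℝ (Fin N) => P.closedLoop q.1 q.2) ∘
        fun z => (z, dv z)) (Ω ∩ (fun z => (z, dv z)) ⁻¹' t) :=
    hK.comp (hpair.mono inter_subset_left) fun z hz => hz.2
  exact ⟨K * max 1 L, _, inter_mem self_mem_nhdsWithin hmem, hcomp⟩

/-- Optimal trajectories solve the closed loop differential equation. -/
theorem IsOptimal.hasDerivWithinAt_closedLoop (h : P.IsOptimal x₀ x u) (hv : P.value x₀ ≠ ⊤)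
    {Ω : Set (EuclideanSpace ℝ (Fin N))}
    {dv : EuclideanSpace ℝ (Fin N) → EuclideanSpace ℝ (Fin N)}
    (hdv : ∀ y ∈ Ω, HasGradientWithinAt P.valueReal (dv y) Ω y) (hx : ∀ t, 0 ≤ t → x t ∈ Ω)
    (hH : ∀ y ∈ Ω, ∀ a, 0 ≤ ⟪dv y, P.f y + P.g y a⟫ + P.runningCost y a)
    (hc : ContinuousOn (fun y => P.closedLoop y (dv y)) Ω) {t : ℝ} (ht : 0 ≤ t) :
    HasDerivWithinAt x (P.closedLoop (x t) (dv (x t))) (Ici t) t := by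
  -- The control equals the feedback only almost everywhere, but under the integral it may be
  -- replaced by this continuous velocity, making `x` right differentiable at every `t ≥ 0`. The
  -- `max` makes `c` continuous on all of `ℝ`.
  set c : ℝ → EuclideanSpace ℝ (Fin N) := fun s => P.closedLoop (x (max s 0)) (dv (x (max s 0)))
  have hmax : ContinuousOn (fun s : ℝ => max s 0) univ := by fun_prop
  have hcc : Continuous c := by
    rw [← continuousOn_univ]
    exact hc.comp (h.1.continuousOn.comp hmax fun s _ => le_max_right s 0)
      fun s _ => hx _ (le_max_right s 0)
  have hxc : ∀ s, 0 ≤ s → x s = x₀ + ∫ τ in (0 : ℝ)..s, c τ := by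
    intro s hs
    rw [h.1.eq_integral s hs]
    congr 1
    refine intervalIntegral.integral_congr_ae ?_
    filter_upwards [h.ae_hamiltonian_eq_zero hv hdv hx] with τ hτ hτs
    rw [uIoc_of_le hs] at hτs
    have := eq_feedback_of_hamiltonian (hH (x τ) (hx τ hτs.1.le)) (hτ hτs.1)
    simp only [c, max_eq_left hτs.1.le, closedLoop, ← this]
  have hd : HasDerivAt (fun s => x₀ + ∫ τ in (0 : ℝ)..s, c τ) (c t) t :=
    (hcc.integral_hasStrictDerivAt 0 t).hasDerivAt.const_add x₀
  have hct : c t = P.closedLoop (x t) (dv (x t)) := by simp only [c, max_eq_left ht]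
  rw [← hct]
  exact hd.hasDerivWithinAt.congr (fun s hs => hxc s (ht.trans hs)) (hxc t ht)

theorem closedLoop_zero {p : EuclideanSpace ℝ (Fin N)}
    (h : ∀ a, 0 ≤ ⟪p, P.f 0 + P.g 0 a⟫ + P.runningCost 0 a) : P.closedLoop 0 p = 0 := by
  have h0 : (0 : EuclideanSpace ℝ (Fin M)) = P.feedback 0 p := by
    refine eq_feedback_of_hamiltonian h ?_
    simp [runningCost, P.f_zero, (P.r_eq_zero_iff 0).2 rfl]
  rw [closedLoop, ← h0, P.f_zero, map_zero, add_zero]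

theorem IsOptimal.mem_reachSet {A : Set (EuclideanSpace ℝ (Fin N))} (h : P.IsOptimal x₀ x u)
    (hx₀ : x₀ ∈ A) {t : ℝ} (ht : 0 ≤ t) : x t ∈ P.reachSet A :=
  subset_closure ⟨x₀, hx₀, x, u, h, t, ht, rfl⟩

theorem subset_reachSet {A : Set (EuclideanSpace ℝ (Fin N))}
    (hopt : ∀ x₀ ∈ A, ∃ x u, P.IsOptimal x₀ x u) : A ⊆ P.reachSet A := fun y hy => by
  obtain ⟨x, u, h⟩ := hopt y hy
  rw [← h.1.initial]
  exact h.mem_reachSet hy le_rfl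

/-- The value does not increase along optimal trajectories, so they stay in a sublevel set of `v`,
which is bounded by radial unboundedness. -/
theorem isCompact_reachSet {A : Set (EuclideanSpace ℝ (Fin N))} (hA : IsCompact A)
    (hrad : Tendsto P.value (Bornology.cobounded (EuclideanSpace ℝ (Fin N))) (𝓝 ⊤))
    (hfin : ∀ x ∈ A, P.value x ≠ ⊤) (hcont : ContinuousOn P.valueReal A) :
    IsCompact (P.reachSet A) := by
  obtain ⟨B, hB⟩ := hA.exists_bound_of_continuousOn hcont
  have hbdd : Bornology.IsBounded {y | P.value y ≤ ENNReal.ofReal B} := by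
    rw [Bornology.isBounded_def]
    filter_upwards [hrad (Ioi_mem_nhds (ENNReal.ofReal_lt_top (r := B)))] with y hy
    exact not_le.2 (show ENNReal.ofReal B < P.value y from hy)
  refine Metric.isCompact_of_isClosed_isBounded isClosed_closure (hbdd.subset ?_).closure
  rintro y ⟨x₀, hx₀, x, u, h, t, ht, rfl⟩
  refine (h.value_le ht).trans ?_
  rw [← ENNReal.ofReal_toReal (hfin x₀ hx₀)]
  exact ENNReal.ofReal_le_ofReal ((le_abs_self _).trans (hB x₀ hx₀))

/-- Otherwise `r` has a positive minimum on `Ω` and the cost is infinite. The exploration starts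
from `{0}`, so the origin must lie where the estimates hold. -/
theorem IsOptimal.zero_mem (h : P.IsOptimal x₀ x u) (hv : P.value x₀ ≠ ⊤)
    {Ω : Set (EuclideanSpace ℝ (Fin N))} (hΩ : IsCompact Ω) (hx : ∀ t, 0 ≤ t → x t ∈ Ω) :
    0 ∈ Ω := by
  by_contra h0
  obtain ⟨y, hy, hmin⟩ := hΩ.exists_isMinOn ⟨x 0, hx 0 le_rfl⟩ P.r_continuous.continuousOn
  have hpos : 0 < P.r y := (P.r_nonneg y).lt_of_ne fun hr =>
    h0 ((P.r_eq_zero_iff y).1 hr.symm ▸ hy)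
  apply hv
  rw [← h.2, cost_eq_lintegral, eq_top_iff]
  calc (⊤ : ℝ≥0∞) = ∫⁻ _ in Ici (0 : ℝ), ENNReal.ofReal (P.r y) := by
        rw [setLIntegral_const, Real.volume_Ici, ENNReal.mul_top (by simpa using hpos)]
    _ ≤ _ := setLIntegral_mono' measurableSet_Ici fun s hs => by
        refine ENNReal.ofReal_le_ofReal ((hmin (hx s hs)).trans ?_)
        rw [runningCost_eq]
        exact le_add_of_nonneg_right (P.inner_weight_nonneg _)

/-- Every point of an explored data set is the initial point of a solution of the closed loop
differential equation in the data set. -/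
theorem GreedyExploration.exists_solution {A Ω : Set (EuclideanSpace ℝ (Fin N))} {tol ε : ℝ}
    {D : Set (EuclideanSpace ℝ (Fin N))} (h : P.GreedyExploration A tol D ε)
    {F : EuclideanSpace ℝ (Fin N) → EuclideanSpace ℝ (Fin N)} (h0Ω : 0 ∈ Ω) (hF0 : F 0 = 0)
    (hF : ∀ x₀ ∈ A, ∀ x u, P.IsOptimal x₀ x u →
      ∀ t, 0 ≤ t → x t ∈ Ω ∧ HasDerivWithinAt x (F (x t)) (Ici t) t) :
    ∀ y ∈ D, ∃ z : ℝ → EuclideanSpace ℝ (Fin N), z 0 = y ∧ ContinuousOn z (Ici 0) ∧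
      ∀ t, 0 ≤ t → z t ∈ D ∩ Ω ∧ HasDerivWithinAt z (F (z t)) (Ici t) t := by
  induction h with
  | init =>
    rintro y rfl
    refine ⟨fun _ => 0, rfl, continuousOn_const, fun t _ => ⟨⟨rfl, h0Ω⟩, ?_⟩⟩
    rw [hF0]
    exact hasDerivWithinAt_const _ _ _
  | @step D ε xa x u _ _ mem _ optimal ih =>
    rintro y (hy | ⟨τ, hτ, rfl⟩)
    · obtain ⟨z, hz0, hzc, hz⟩ := ih y hy
      exact ⟨z, hz0, hzc, fun t ht => ⟨⟨Or.inl (hz t ht).1.1, (hz t ht).1.2⟩, (hz t ht).2⟩⟩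
    · have hτ0 : (0 : ℝ) ≤ τ := hτ
      refine ⟨fun t => x (τ + t), by simp, (optimal.1.shift hτ0).continuousOn, fun t ht => ?_⟩
      have h1 := hF xa mem x u optimal (τ + t) (add_nonneg hτ0 ht)
      refine ⟨⟨Or.inr ⟨τ + t, add_nonneg hτ0 ht, rfl⟩, h1.1⟩, ?_⟩
      have h2 : HasDerivWithinAt (fun t => τ + t) 1 (Ici t) t :=
        (hasDerivWithinAt_id t (Ici t)).const_add τ
      have h3 := h1.2.scomp t h2 (fun s (hs : t ≤ s) => add_le_add_right hs τ)
      simpa using! h3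

theorem ExplorationOutput.infDist_le {A D : Set (EuclideanSpace ℝ (Fin N))} {tol : ℝ}
    (h : P.ExplorationOutput A tol D) :
    D.Nonempty ∧ ∀ y ∈ A, Metric.infDist y D ≤ tol := by
  have hne : ∀ {D : Set (EuclideanSpace ℝ (Fin N))} {ε : ℝ},
      P.GreedyExploration A tol D ε → D.Nonempty := by
    intro D ε hD
    induction hD with
    | init => exact singleton_nonempty 0
    | step _ _ _ _ _ ih => exact ih.mono subset_union_left
  obtain ⟨ε, hG, hε⟩ := h
  refine ⟨hne hG, ?_⟩
  cases hG with
  -- The initial `ε = tol + 1` exceeds `tol`, so a terminated run has made a step. Its last `ε` is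
  -- the maximal distance to the set before the last trajectory was added, and adding it can only
  -- shrink distances.
  | init => exact absurd hε (by linarith)
  | step prev _ _ farthest _ =>
    intro y hy
    exact (Metric.infDist_le_infDist_of_subset subset_union_left (hne prev)).trans
      ((farthest hy).trans hε)

end ControlProblem

end

/-! ### Assembly of the error bound. -/

theorem mainTheorem1 {N M : ℕ} (P : ControlProblem N M)
    (A : Set (EuclideanSpace ℝ (Fin N))) (hA : IsCompact A)
    -- every initial state in `A` has an optimal process
    (hopt : ∀ x₀ ∈ A, ∃ x u, P.IsOptimal x₀ x u)
    -- `f` and `g` are `C¹` near every point of `𝒯(A)`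
    (hf : ∀ x ∈ P.reachSet A, ContDiffAt ℝ 1 P.f x)
    (hg : ∀ x ∈ P.reachSet A, ContDiffAt ℝ 1 P.g x)
    -- the value function is radially unbounded
    (hrad : Tendsto P.value (Bornology.cobounded (EuclideanSpace ℝ (Fin N))) (𝓝 ⊤))
    -- the value function is `C¹` on `𝒯(A)` with gradient `dv`
    (dv : EuclideanSpace ℝ (Fin N) → EuclideanSpace ℝ (Fin N))
    (hdv : P.HasC1ValueOn (P.reachSet A) dv)
    -- `k` is a `C⁴` s.p.d. kernel on a convex set `S ⊇ conv 𝒯(A)` with interior points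
    -- (`S = conv 𝒯(A)` if the latter has interior points)
    (S : Set (EuclideanSpace ℝ (Fin N))) (hSconv : Convex ℝ S) (hSint : (interior S).Nonempty)
    (hS : convexHull ℝ (P.reachSet A) ⊆ S)
    (k : EuclideanSpace ℝ (Fin N) → EuclideanSpace ℝ (Fin N) → ℝ)
    (hk : IsSPDKernelOn k S)
    (hkC4 : ContDiffOn ℝ 4 (Function.uncurry k) (S ×ˢ S))
    -- `H` is the reproducing kernel Hilbert space of `k`
    {H : Type*} [NormedAddCommGroup H] [InnerProductSpace ℝ H] [CompleteSpace H]
    [RKHS ℝ H S ℝ] (hH : ∀ x y : S, RKHS.kernel H x y (1 : ℝ) = k x y)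
    -- on `𝒯(A)` the value function, with its gradient `dv`, belongs to the RKHS
    (hv : ∃ w : H, ∀ x ∈ P.reachSet A, extendZero (w : S → ℝ) x = P.valueReal x ∧
      gradientWithin (extendZero (w : S → ℝ)) S x = dv x) :
    ∀ T : ℝ, 0 < T → ∃ C : ℝ, 0 < C ∧
      ∀ εd εf : ℝ, 0 ≤ εd → 0 ≤ εf →
      ∀ D : Set (EuclideanSpace ℝ (Fin N)), P.ExplorationOutput A εd D →
      ∀ s : EuclideanSpace ℝ (Fin N) → ℝ,
        VKOGAOutput k S P.valueReal dv D εf s →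
      ∀ x₀ ∈ A, ∀ x u, P.IsOptimal x₀ x u → ∀ t ∈ Icc (0 : ℝ) T,
        |P.valueReal (x t) - s (x t)| +
          ‖dv (x t) - gradientWithin s S (x t)‖ ≤ C * εd + εf := by
  intro T hT
  rcases A.eq_empty_or_nonempty with rfl | ⟨a₀, ha₀⟩
  · exact ⟨1, one_pos, fun _ _ _ _ _ _ _ _ x₀ hx₀ => absurd hx₀ (notMem_empty x₀)⟩
  obtain ⟨w, hw⟩ := hv
  set Ω := P.reachSet A
  have hAΩ : A ⊆ Ω := ControlProblem.subset_reachSet hopt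
  have hfin : ∀ y ∈ A, P.value y ≠ ⊤ := fun y hy => hdv.finite y (hAΩ hy)
  have hΩ : IsCompact Ω :=
    ControlProblem.isCompact_reachSet hA hrad hfin (hdv.continuousOn.mono hAΩ)
  set Q := convexHull ℝ Ω
  have hΩQ : Ω ⊆ Q := subset_convexHull ℝ Ω
  have hUS : UniqueDiffOn ℝ S := uniqueDiffOn_convex hSconv hSint
  set φ := featureMap S H
  have hφk : ∀ x ∈ S, ∀ y ∈ S, ⟪φ x, φ y⟫ = k x y := fun x hx y hy =>
    inner_featureMap_featureMap hH hx hy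
  have hφd : DifferentiableOn ℝ φ S := fun y hy =>
    differentiableWithinAt_of_inner_eq hSconv hSint (hkC4.of_le (by norm_num)) hφk hy
  obtain ⟨L, hL0, hL⟩ := exists_norm_sub_le_of_inner_eq hUS (hkC4.of_le (by norm_num)) hφk
    (convex_convexHull ℝ Ω) (isCompact_convexHull_of_finiteDimensional hΩ) hS
  obtain ⟨L', hL'0, hL'⟩ := exists_norm_fderivWithin_sub_le_of_inner_eq hSconv hSint hkC4 hφk
    (convex_convexHull ℝ Ω) (isCompact_convexHull_of_finiteDimensional hΩ) hS
  have hgrad : ∀ y ∈ S, HasGradientWithinAt (extendZero (w : S → ℝ))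
      ((fderivWithin ℝ φ S y).adjoint w) S y := fun y hy =>
    (hasGradientWithinAt_inner_left (hφd y hy) w).congr
      (fun z hz => (inner_featureMap_left hz w).symm) (inner_featureMap_left hy w).symm
  have hwΩ : ∀ y ∈ Ω, ⟪φ y, w⟫ = P.valueReal y ∧ (fderivWithin ℝ φ S y).adjoint w = dv y := by
    intro y hy
    have hyS := hS (hΩQ hy)
    refine ⟨(inner_featureMap_left hyS w).trans (hw y hy).1, ?_⟩
    rw [← (hw y hy).2, (hgrad y hyS).gradientWithin_eq (hUS y hyS)]
  -- Differentiability relative to `Ω` at every point, including its boundary, is inherited from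
  -- `w`, which is differentiable within `S` and agrees with `v` on `Ω`.
  have hvgrad : ∀ y ∈ Ω, HasGradientWithinAt P.valueReal (dv y) Ω y := fun y hy => by
    rw [← (hwΩ y hy).2]
    have := (hgrad y (hS (hΩQ hy))).hasFDerivWithinAt.mono (hΩQ.trans hS)
    exact hasGradientWithinAt_iff_hasFDerivWithinAt.2
      (this.congr (fun z hz => (hw z hz).1.symm) (hw y hy).1.symm)
  have hdvL : LipschitzOnWith (‖w‖ * L').toNNReal dv Ω := by
    refine LipschitzOnWith.of_dist_le_mul fun y hy z hz => ?_
    rw [Real.coe_toNNReal _ (by positivity), dist_eq_norm, dist_eq_norm, ← (hwΩ y hy).2,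
      ← (hwΩ z hz).2]
    have : (fderivWithin ℝ φ S y).adjoint w - (fderivWithin ℝ φ S z).adjoint w =
        (fderivWithin ℝ φ S y - fderivWithin ℝ φ S z).adjoint w := by rw [map_sub]; simp
    rw [this]
    refine (ContinuousLinearMap.le_opNorm _ _).trans ?_
    rw [LinearIsometryEquiv.norm_map]
    calc _ ≤ L' * ‖y - z‖ * ‖w‖ :=
          mul_le_mul_of_nonneg_right (hL' y (hΩQ hy) z (hΩQ hz)) (norm_nonneg _)
      _ = _ := by ring
  have hHJB : ∀ y ∈ Ω, ∀ a, 0 ≤ ⟪dv y, P.f y + P.g y a⟫ + P.runningCost y a := fun y hy a =>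
    hdv.hamiltonian_nonneg hf hg hy a
  obtain ⟨K, hK⟩ := ControlProblem.exists_lipschitzOnWith_closedLoop hΩ hf hg hdvL
  have h0Ω : (0 : EuclideanSpace ℝ (Fin N)) ∈ Ω := by
    obtain ⟨x, u, h⟩ := hopt a₀ ha₀
    exact h.zero_mem (hfin a₀ ha₀) hΩ fun t ht => h.mem_reachSet ha₀ ht
  have hF0 : P.closedLoop 0 (dv 0) = 0 := ControlProblem.closedLoop_zero (hHJB 0 h0Ω)
  have hsol : ∀ x₀ ∈ A, ∀ x u, P.IsOptimal x₀ x u → ∀ t, 0 ≤ t →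
      x t ∈ Ω ∧ HasDerivWithinAt x (P.closedLoop (x t) (dv (x t))) (Ici t) t :=
    fun x₀ hx₀ x u h t ht => ⟨h.mem_reachSet hx₀ ht,
      h.hasDerivWithinAt_closedLoop (hfin x₀ hx₀) hvgrad (fun s hs => h.mem_reachSet hx₀ hs)
        hHJB hK.continuousOn ht⟩
  -- Residual norm, Lipschitz constants of the features, and Grönwall factor. Since `C` may vanish,
  -- `C + 1` is used below.
  set C := ‖w‖ * (L + L') * Real.exp (K * T)
  have hC : 0 ≤ C := by positivity
  refine ⟨C + 1, by positivity, ?_⟩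
  intro εd εf hεd hεf D hD s hs x₀ hx₀ x u hx t ht
  have hDsol : ∀ y ∈ D, ∃ z : ℝ → EuclideanSpace ℝ (Fin N), z 0 = y ∧ ContinuousOn z (Ici 0) ∧
      ∀ t, 0 ≤ t → z t ∈ D ∩ Ω ∧ HasDerivWithinAt z (P.closedLoop (z t) (dv (z t))) (Ici t) t := by
    obtain ⟨ε, hG, -⟩ := hD
    exact hG.exists_solution (F := fun y => P.closedLoop y (dv y)) h0Ω hF0 hsol
  obtain ⟨hDne, hDdist⟩ := hD.infDist_le
  have hDΩ : D ⊆ Ω := fun y hy => by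
    obtain ⟨z, rfl, -, hz⟩ := hDsol y hy
    exact (hz 0 le_rfl).1.2
  obtain ⟨X, hVK, herrX⟩ := hs
  obtain ⟨hXD, hX⟩ := hVK.eq_zero_or_isHermiteInterpolant
  have hXΩ : (X : Set (EuclideanSpace ℝ (Fin N))) ⊆ Ω := hXD.trans hDΩ
  obtain ⟨σ, hσ, hσw⟩ : ∃ σ : H, (∀ z ∈ S, s z = ⟪φ z, σ⟫) ∧ ‖w - σ‖ ≤ ‖w‖ := by
    rcases hX with ⟨-, rfl⟩ | hX
    · exact ⟨0, by simp, by simp⟩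
    · exact norm_residual_le hUS hφd hφk (hXΩ.trans (hΩQ.trans hS)) hX
        fun y hy => hwΩ y (hXΩ hy)
  have herrD : ∀ y ∈ D, hermiteError S P.valueReal dv s y ≤ εf := by
    intro y hy
    by_cases hyX : y ∈ X
    · rcases hX with ⟨rfl, -⟩ | hX
      · exact absurd hyX (Finset.notMem_empty y)
      · rw [hermiteError, (hX.2 y hyX).1, (hX.2 y hyX).2]
        simpa using hεf
    · exact herrX y ⟨hy, hyX⟩
  -- The distance to `D` need not be attained, so a near-minimizer at distance less than `δ` is
  -- used, and `δ` tends to `εd` afterwards.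
  have hCδ : ∀ δ, εd < δ → hermiteError S P.valueReal dv s (x t) ≤ C * δ + εf := by
    intro δ hδ
    obtain ⟨y, hy, hyδ⟩ := (Metric.infDist_lt_iff hDne).1 ((hDdist x₀ hx₀).trans_lt hδ)
    obtain ⟨z, hz0, hzc, hz⟩ := hDsol y hy
    have hdist := dist_le_of_trajectories_ODE_of_mem (s := fun _ => Ω)
      (v := fun _ y => P.closedLoop y (dv y)) (a := 0) (b := T) (f := x) (g := z) (δ := δ)
      (fun _ _ => hK) (hx.1.continuousOn.mono Icc_subset_Ici_self)
      (fun τ hτ => (hsol x₀ hx₀ x u hx τ hτ.1).2) (fun τ hτ => (hsol x₀ hx₀ x u hx τ hτ.1).1)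
      (hzc.mono Icc_subset_Ici_self) (fun τ hτ => (hz τ hτ.1).2) (fun τ hτ => (hz τ hτ.1).1.2)
      (by rw [hx.1.initial, hz0]; exact hyδ.le) t ht
    rw [sub_zero, dist_eq_norm] at hdist
    have hδ0 : 0 ≤ δ := hεd.trans hδ.le
    have herr := hermiteError_le_add hUS hφd ((hΩQ.trans hS : Ω ⊆ S))
      (fun a ha b hb => hL a (hΩQ ha) b (hΩQ hb)) (fun a ha b hb => hL' a (hΩQ ha) b (hΩQ hb))
      hwΩ hσ (hsol x₀ hx₀ x u hx t ht.1).1 (hz t ht.1).1.2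
    have hexp : Real.exp (K * t) ≤ Real.exp (K * T) :=
      Real.exp_le_exp.2 (mul_le_mul_of_nonneg_left ht.2 K.coe_nonneg)
    have hzD := herrD _ (hz t ht.1).1.1
    have hprod : ‖w - σ‖ * (L + L') * ‖x t - z t‖ ≤ ‖w‖ * (L + L') * (δ * Real.exp (K * T)) := by
      gcongr
      exact hdist.trans (by gcongr)
    calc _ ≤ _ := herr
      _ ≤ εf + ‖w‖ * (L + L') * (δ * Real.exp (K * T)) := add_le_add hzD hprod
      _ = _ := by simp only [C]; ring
  have hlim : hermiteError S P.valueReal dv s (x t) ≤ C * εd + εf := by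
    have hc : Tendsto (fun δ => C * δ + εf) (𝓝[>] εd) (𝓝 (C * εd + εf)) :=
      (Continuous.tendsto (by fun_prop) εd).mono_left nhdsWithin_le_nhds
    refine ge_of_tendsto hc ?_
    filter_upwards [self_mem_nhdsWithin] with δ hδ using hCδ δ hδ
  calc _ ≤ C * εd + εf := hlim
    _ ≤ (C + 1) * εd + εf := by gcongr; linarith
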